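/- **Definitions.** All manifolds and maps are $C^\infty$. *Cusp singularity.* Let $X\subset\mathbb R^n$ ($n\ge 1$) and $p\in X$ be such that $X\setminus\{p\}$ is an embedded submanifold of $\mathbb R^n$ of dimension $m\ge1$. The tangent cone $C(X,p)$ is the set of all $t\nu$ with $t>0$, $|\nu|=1$ and $\nu=\lim_k \frac{p_k-p}{|p_k-p|}$ for some sequence $p_k\in X\setminus\{p\}$ with $p_k\to p$. We say that $X$ has a *cusp singularity of order 2* at $p$ if $C(X,p)$ is a single half-line and, in suitable smooth local coordinates $(x,z)\in\mathbb R^{n-1}\times\mathbb R$ of $\mathbb R^n$ centred at $p$ with $C(X,p)=\mathbb R_{>0}\,\partial_z$, there are a neighborhood $U'$ of $p$ and a set $\widetilde X$ with $$X\cap U'=\beta(\widetilde X),\qquad \beta:\mathbb R^{n-1}\times[0,\infty)\to\mathbb R^n,\quad \beta(u,z)=(z^2u,z),$$ where $\widetilde X\subset\mathbb R^{n-1}\times[0,\infty)$ is an embedded $m$-dimensional submanifold with boundary whose boundary is contained in $E=\mathbb R^{n-1}\times\{0\}$ and which intersects $E$ transversally (and $\beta(\widetilde X)$ lies in the domain of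 the coordinates). The manifold with boundary $\widetilde X$ is called the *resolution* of $X$. *Cusp metric.* A *cusp metric* on an $m$-dimensional manifold with boundary $M$ is a smooth symmetric positive semidefinite $2$-tensor field $\mathbf g$ on $M$, positive definite in the interior of $M$, such that near every boundary point there are smooth coordinates $(r,\varphi_1,\dots,\varphi_{m-1})$, with $r\ge 0$ and the boundary given by $r=0$, in which $$\mathbf g=\bigl(1-2r^2S+O(r^3)\bigr)\,dr^2+r^4\Bigl(2\sum_{i}b_i\,dr\,d\varphi_i+\sum_{i,j}c_{ij}\,d\varphi_i\,d\varphi_j\Bigr),$$ where $S=S(\varphi)$, $b_i=b_i(r,\varphi)$ and $c_{ij}=c_{ji}=c_{ij}(r,\varphi)$ are smooth, $O(r^3)$ stands for $r^3$ times a smooth function of $(r,\varphi)$, and the matrix $(c_{ij}(0,\varphi))$ is positive definite for each $\varphi$. **Proposition 2.2.** Let $X\subset\mathbb R^n$ have a cusp singularity of order 2 at $p$, with resolution $\widetilde X$. Let $g$ be a smooth Riemannian metric on $\mathbb R^n$ and $g_X$ its restriction to $X\setminus\{p\}$. Then the pullback of $g_X$ under $\beta$ to $\widetilde X\setminus\partial\widetilde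 X$ extends to a cusp metric on $\widetilde X$. -/

import Mathlib

open scoped Manifold ContDiff Topology
open Filter

noncomputable section

namespace CuspSing

/-- The space `ℝ^{n-1} × ℝ` with `n = d + 1`; its points are written `(x, z)` below the quadratic
blowing-up and `(u, z)` above it. -/
abbrev Coord (d : ℕ) : Type := EuclideanSpace ℝ (Fin d) × ℝ

/-- The quadratic blowing-down map `(u, z) ↦ (z² u, z)`. -/
def quadBlowDown (d : ℕ) (w : Coord d) : Coord d := (w.2 ^ 2 • w.1, w.2)

/-- The cone of limits of oriented secant half-lines through `p` from points of `X`. -/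
def secantCone {n : ℕ} (X : Set (EuclideanSpace ℝ (Fin n))) (p : EuclideanSpace ℝ (Fin n)) :
    Set (EuclideanSpace ℝ (Fin n)) :=
  {w | ∃ (t : ℝ) (ν : EuclideanSpace ℝ (Fin n)), 0 < t ∧ ‖ν‖ = 1 ∧ w = t • ν ∧
    ∃ s : ℕ → EuclideanSpace ℝ (Fin n), (∀ i, s i ∈ X \ {p}) ∧ Tendsto s atTop (𝓝 p) ∧
      Tendsto (fun i => ‖s i - p‖⁻¹ • (s i - p)) atTop (𝓝 ν)}

/-- `Y ⊆ ℝⁿ` is a smooth embedded `m`-dimensional submanifold (without boundary): its subspace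
topology carries a smooth manifold structure for which the inclusion is a smooth embedding. -/
def IsSubmanifold {n : ℕ} (m : ℕ) (Y : Set (EuclideanSpace ℝ (Fin n))) : Prop :=
  ∃ (_ : ChartedSpace (EuclideanSpace ℝ (Fin m)) Y) (_ : IsManifold (𝓡 m) ∞ Y),
    Manifold.IsSmoothEmbedding (𝓡 m) (𝓡 n) ∞ (Subtype.val : Y → EuclideanSpace ℝ (Fin n))

/-- The given structure of a smooth `(k+1)`-dimensional manifold with boundary on the set `Y` makes
it a submanifold of `ℝ^d × [0, ∞)` whose boundary is contained in `E = {z = 0}` and which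
intersects `E` transversally. -/
structure IsPSubmanifold {d : ℕ} (k : ℕ) (Y : Set (Coord d))
    [ChartedSpace (EuclideanHalfSpace (k + 1)) Y] : Prop where
  nonneg : ∀ y ∈ Y, 0 ≤ y.2
  embedded : Manifold.IsSmoothEmbedding (𝓡∂ (k + 1)) 𝓘(ℝ, Coord d) ∞ (Subtype.val : Y → Coord d)
  boundary_subset : ∀ y : Y, (𝓡∂ (k + 1)).IsBoundaryPoint y → (y : Coord d).2 = 0
  transversal : ∀ y : Y, (y : Coord d).2 = 0 → ∀ w : Coord d,
    ∃ (v : TangentSpace (𝓡∂ (k + 1)) y) (e : Coord d),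
      let v' : Coord d := mfderiv (𝓡∂ (k + 1)) 𝓘(ℝ, Coord d) (Subtype.val : Y → Coord d) y v
      e.2 = 0 ∧ w = v' + e

/-- `κ` is (the inverse of) a smooth coordinate system `(x, z)` of `ℝ^{d+1}` near `p`, centred
at `p`. -/
structure IsCoordSystem {d : ℕ} (p : EuclideanSpace ℝ (Fin (d + 1)))
    (κ : OpenPartialHomeomorph (Coord d) (EuclideanSpace ℝ (Fin (d + 1)))) : Prop where
  zero_mem : (0 : Coord d) ∈ κ.source
  map_zero : κ 0 = p
  contDiffOn : ContDiffOn ℝ ∞ κ κ.source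
  contDiffOn_symm : ContDiffOn ℝ ∞ κ.symm κ.target

/-- `X ⊆ ℝ^{d+1}` has a cusp singularity of order two at `p`, as seen in the coordinates `κ`, and
the manifold with boundary `Xt` is its resolution (of dimension `k + 1`). -/
structure IsCuspSingularityWithResolution {d : ℕ} (k : ℕ)
    (X : Set (EuclideanSpace ℝ (Fin (d + 1)))) (p : EuclideanSpace ℝ (Fin (d + 1)))
    (κ : OpenPartialHomeomorph (Coord d) (EuclideanSpace ℝ (Fin (d + 1))))
    (Xt : Set (Coord d)) [ChartedSpace (EuclideanHalfSpace (k + 1)) Xt] : Prop where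
  mem : p ∈ X
  submanifold : IsSubmanifold (k + 1) (X \ {p})
  coord : IsCoordSystem p κ
  /-- The tangent cone is the single half-line spanned by `∂/∂z`. -/
  cone : secantCone X p = {w | ∃ t : ℝ, 0 < t ∧ w = t • fderiv ℝ κ 0 ((0, 1) : Coord d)}
  resolution : IsPSubmanifold k Xt
  subset_source : quadBlowDown d '' Xt ⊆ κ.source
  /-- Near `p`, the set `X` is the image of `Xt` under the quadratic blowing-down map. -/
  model : ∃ U ∈ 𝓝 p, X ∩ U = κ '' (quadBlowDown d '' Xt)

/-- The coordinates `φ = (φ₁, …, φ_k)` of a point `(r, φ₁, …, φ_k)`. -/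
def angular {k : ℕ} (y : EuclideanSpace ℝ (Fin (k + 1))) : EuclideanSpace ℝ (Fin k) :=
  WithLp.toLp 2 fun i => y i.succ

section CuspMetric

variable {k : ℕ} {M : Type*} [TopologicalSpace M] [ChartedSpace (EuclideanHalfSpace (k + 1)) M]

/-- In the coordinates `e = (r, φ₁, …, φ_k)` the symmetric two-tensor `g` has the form
`(1 - 2 r² S + O(r³)) dr² + r⁴ (2 ∑ bᵢ dr dφᵢ + ∑ cᵢⱼ dφᵢ dφⱼ)` with `S = S(φ)`, `bᵢ`, `cᵢⱼ` smooth
and `c` positive definite at `r = 0`; here `O(r³)` is `r³ a` with `a = a(r, φ)` smooth.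
It is written as an identity of quadratic forms, `V` being the vector of components of `v`. -/
def HasCuspForm (e : OpenPartialHomeomorph M (EuclideanHalfSpace (k + 1)))
    (g : (x : M) → TangentSpace (𝓡∂ (k + 1)) x →L[ℝ] TangentSpace (𝓡∂ (k + 1)) x →L[ℝ] ℝ) : Prop :=
  ∃ (S : EuclideanSpace ℝ (Fin k) → ℝ) (a : EuclideanSpace ℝ (Fin (k + 1)) → ℝ)
    (b : Fin k → EuclideanSpace ℝ (Fin (k + 1)) → ℝ)
    (c : Fin k → Fin k → EuclideanSpace ℝ (Fin (k + 1)) → ℝ),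
    ContDiffOn ℝ ∞ S (angular '' (e.extend (𝓡∂ (k + 1))).target) ∧
    ContDiffOn ℝ ∞ a (e.extend (𝓡∂ (k + 1))).target ∧
    (∀ i, ContDiffOn ℝ ∞ (b i) (e.extend (𝓡∂ (k + 1))).target) ∧
    (∀ i j, ContDiffOn ℝ ∞ (c i j) (e.extend (𝓡∂ (k + 1))).target) ∧
    (∀ y ∈ (e.extend (𝓡∂ (k + 1))).target, ∀ i j, c i j y = c j i y) ∧
    (∀ y ∈ (e.extend (𝓡∂ (k + 1))).target, y 0 = 0 →
      ∀ ξ : Fin k → ℝ, ξ ≠ 0 → 0 < ∑ i, ∑ j, c i j y * ξ i * ξ j) ∧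
    ∀ x ∈ e.source, ∀ v : TangentSpace (𝓡∂ (k + 1)) x,
      let y : EuclideanSpace ℝ (Fin (k + 1)) := e.extend (𝓡∂ (k + 1)) x
      let r : ℝ := y 0
      let V : EuclideanSpace ℝ (Fin (k + 1)) :=
        mfderiv (𝓡∂ (k + 1)) 𝓘(ℝ, EuclideanSpace ℝ (Fin (k + 1))) (e.extend (𝓡∂ (k + 1))) x v
      g x v v = (1 - 2 * r ^ 2 * S (angular y) + r ^ 3 * a y) * V 0 ^ 2 +
        r ^ 4 * (2 * ∑ i, b i y * V 0 * V i.succ + ∑ i, ∑ j, c i j y * V i.succ * V j.succ)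

/-- A cusp metric (of order two) on a smooth manifold with boundary: a smooth symmetric positive
semidefinite two-tensor, positive definite in the interior, which near every boundary point has
the cusp form in suitable coordinates. In every chart of the maximal atlas the boundary is given
by the vanishing of the first coordinate. -/
structure IsCuspMetric [IsManifold (𝓡∂ (k + 1)) ∞ M]
    (g : (x : M) → TangentSpace (𝓡∂ (k + 1)) x →L[ℝ] TangentSpace (𝓡∂ (k + 1)) x →L[ℝ] ℝ) :
    Prop where
  smooth : ContMDiff (𝓡∂ (k + 1)) ((𝓡∂ (k + 1)).prod 𝓘(ℝ, EuclideanSpace ℝ (Fin (k + 1)) →L[ℝ]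
      EuclideanSpace ℝ (Fin (k + 1)) →L[ℝ] ℝ)) ∞
    (fun x : M => Bundle.TotalSpace.mk' (EuclideanSpace ℝ (Fin (k + 1)) →L[ℝ]
      EuclideanSpace ℝ (Fin (k + 1)) →L[ℝ] ℝ)
      (E := fun x : M => TangentSpace (𝓡∂ (k + 1)) x →L[ℝ] TangentSpace (𝓡∂ (k + 1)) x →L[ℝ] ℝ)
      x (g x))
  symm : ∀ x v w, g x v w = g x w v
  nonneg : ∀ x v, 0 ≤ g x v v
  pos_interior : ∀ x, (𝓡∂ (k + 1)).IsInteriorPoint x → ∀ v, v ≠ 0 → 0 < g x v v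
  cusp_form : ∀ x : M, (𝓡∂ (k + 1)).IsBoundaryPoint x →
    ∃ e ∈ IsManifold.maximalAtlas (𝓡∂ (k + 1)) ∞ M, x ∈ e.source ∧ HasCuspForm e g

end CuspMetric

end CuspSing

end

/-! The pullback tensor is defined and smooth on all of `Xt`, because `κ ∘ quadBlowDown d` is smooth
up to the boundary. Only two points need an argument: positivity in the interior and the cusp form
at the boundary. Transversality together with `0 ≤ z` shows that `Xt` meets `{z = 0}` exactly in its
boundary. In the interior the derivatives of the inclusion, of the blow-down map and of `κ` are
therefore all injective.

For the cusp form, let `h` be the metric in the coordinates `(x, z)`. Since the blow-down map sends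
`{z = 0}` to the origin, `h` pulled back along it is `H₀ + z H₁ + z² R`, with `H₀` and `H₁`
independent of `u`. The differential of the map has components `z² du + 2 z u dz` and `dz`. One can
therefore solve for a radial function `ρ = α z + z² (β + λ(u)) + z³ (q(u,u) + μ(u))` whose square
`dρ²` absorbs the `dz²` terms below order `z²` and the mixed `dz du` terms below order `z⁴`. What
remains is `z² A dρ² + z⁴ (B(du) dρ + C(du, du))`, where on `{z = 0}` the form `C` is `H₀` on the
component orthogonal to `∂/∂z`, hence positive definite. This ambient computation is
`exists_cuspForm_quadBlowDown`.

On `Xt`, transversality makes `ρ` the first coordinate `r` of a boundary chart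
(`exists_isParametrization_of_radial`). Expressing `du` through `dr` and `dφ`, and expanding the `r²
dr²` coefficient to first order in `r` by Hadamard's lemma, gives `S`, `a`, `b`, `c`
(`exists_hasCuspForm`). -/

noncomputable section

namespace CuspSing

/-! ### Hadamard's lemma and smooth cut-offs. -/

section Hadamard

open MeasureTheory Set

variable {E F : Type*} [NormedAddCommGroup E] [NormedSpace ℝ E]
  [NormedAddCommGroup F] [NormedSpace ℝ F]

/-- The integral over `[0, 1]` of a smooth family is a smooth function of the parameter. -/
theorem contDiff_intervalIntegral_of_contDiff [CompleteSpace F] {f : E → ℝ → F}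
    (hf : ContDiff ℝ ∞ fun q : E × ℝ => f q.1 q.2) :
    ContDiff ℝ ∞ fun x => ∫ t in (0 : ℝ)..1, f x t := by
  -- The integral is the value at `0` of a convolution with the indicator of `[-1, 0]`. The cut-off
  -- `χ` gives `f x` compact support and equals `1` on `[-1, 1]`, so the integral is unaffected.
  let χ : ContDiffBump (0 : ℝ) := ⟨1, 2, by norm_num, by norm_num⟩
  let φ : ℝ → ℝ := indicator (Icc (-1) 0) 1
  let g : E → ℝ → F := fun x s => χ s • f x s
  have hφ : LocallyIntegrable φ volume :=
    ((integrable_indicator_iff measurableSet_Icc).2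
      (integrableOn_const (by simp) (by simp))).locallyIntegrable
  have hg : ContDiffOn ℝ ∞ (fun q : E × ℝ => g q.1 q.2) (univ ×ˢ univ) := by
    rw [univ_prod_univ, contDiffOn_univ]
    exact (χ.contDiff.comp contDiff_snd).smul hf
  have key := contDiffOn_convolution_right_with_param_comp (μ := volume) (n := (⊤ : ℕ∞))
    (ContinuousLinearMap.lsmul ℝ ℝ : ℝ →L[ℝ] F →L[ℝ] F)
    (s := (univ : Set E)) (v := fun _ => (0 : ℝ)) contDiffOn_const (f := φ) (g := g)
    (k := Metric.closedBall 0 2) isOpen_univ (isCompact_closedBall 0 2)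
    (fun p x _ hx => by
      have : χ x = 0 := by
        apply χ.zero_of_le_dist
        exact (not_le.1 hx).le
      simp [g, this]) hφ hg
  rw [contDiffOn_univ] at key
  convert key using 1
  ext x
  rw [convolution_def]
  have h1 : (fun t => (ContinuousLinearMap.lsmul ℝ ℝ : ℝ →L[ℝ] F →L[ℝ] F) (φ t) (g x (0 - t)))
      = indicator (Icc (-1) 0) fun t => f x (-t) := by
    ext t
    by_cases ht : t ∈ Icc (-1 : ℝ) 0
    · have : χ (-t) = 1 := by
        apply χ.one_of_mem_closedBall
        rw [mem_closedBall_zero_iff, Real.norm_eq_abs, abs_neg, abs_le]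
        exact ⟨ht.1, ht.2.trans zero_le_one⟩
      simp [φ, g, ht, this]
    · simp [φ, ht]
  rw [h1, integral_indicator measurableSet_Icc, integral_Icc_eq_integral_Ioc,
    ← intervalIntegral.integral_of_le (by norm_num), intervalIntegral.integral_comp_neg (f x)]
  simp

/-- Hadamard's lemma: the difference of a smooth function and its restriction to the kernel of a
linear form, along the direction `v`, is divisible by that form, with smooth quotient. -/
theorem exists_contDiff_hadamard [CompleteSpace F] {f : E → F} (hf : ContDiff ℝ ∞ f)
    (l : E →L[ℝ] ℝ) (v : E) :
    ∃ g : E → F, ContDiff ℝ ∞ g ∧ (∀ y, f y = f (y - l y • v) + l y • g y) ∧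
      ∀ y, l y = 0 → g y = fderiv ℝ f y v := by
  -- The quotient is the mean of the derivative along the segment from `y - l y • v` to `y`; the
  -- fundamental theorem of calculus gives the identity.
  refine ⟨fun y => ∫ t in (0 : ℝ)..1, fderiv ℝ f (y - ((1 - t) * l y) • v) v, ?_, ?_, ?_⟩
  · apply contDiff_intervalIntegral_of_contDiff
      (f := fun y t => fderiv ℝ f (y - ((1 - t) * l y) • v) v)
    have h1 : ContDiff ℝ ∞ (fderiv ℝ f) := hf.fderiv_right (by simp)
    have h2 : ContDiff ℝ ∞ fun q : E × ℝ => q.1 - ((1 - q.2) * l q.1) • v := by fun_prop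
    exact (h1.comp h2).clm_apply contDiff_const
  · intro y
    have hd : ∀ t : ℝ, HasDerivAt (fun t : ℝ => f (y - ((1 - t) * l y) • v))
        (l y • fderiv ℝ f (y - ((1 - t) * l y) • v) v) t := by
      intro t
      have h1 : HasDerivAt (fun t : ℝ => y - ((1 - t) * l y) • v) (l y • v) t := by
        have := ((((hasDerivAt_id t).const_sub 1).mul_const (l y)).smul_const v).const_sub y
        simpa using this
      have := ((hf.differentiable (by simp)) _).hasFDerivAt.comp_hasDerivAt t h1
      simpa [Function.comp_def] using this
    have hc : Continuous fun t : ℝ => l y • fderiv ℝ f (y - ((1 - t) * l y) • v) v := by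
      have h1 : Continuous (fderiv ℝ f) := hf.continuous_fderiv (by simp)
      have h2 : Continuous fun t : ℝ => y - ((1 - t) * l y) • v := by fun_prop
      exact ((h1.comp h2).clm_apply continuous_const).const_smul _
    have := intervalIntegral.integral_eq_sub_of_hasDerivAt (a := 0) (b := 1)
      (fun t _ => hd t) (hc.intervalIntegrable _ _)
    rw [intervalIntegral.integral_smul] at this
    simp only [sub_self, zero_mul, zero_smul, sub_zero, one_mul] at this
    rw [this]; abel
  · intro y hy
    simp [hy]

/-- A function which is smooth near a point agrees near that point with a globally smooth one. -/
theorem exists_contDiff_eventuallyEq [FiniteDimensional ℝ E] {f : E → F} {s : Set E} {x : E}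
    (hs : s ∈ 𝓝 x) (hf : ContDiffOn ℝ ∞ f s) :
    ∃ f' : E → F, ContDiff ℝ ∞ f' ∧ f' =ᶠ[𝓝 x] f := by
  obtain ⟨ε, hε, hεs⟩ := Metric.nhds_basis_closedBall.mem_iff.1 hs
  let χ : ContDiffBump x := ⟨ε / 3, ε / 2, by positivity, by linarith⟩
  refine ⟨fun y => χ y • f y, ?_, ?_⟩
  · rw [contDiff_iff_contDiffAt]
    intro y
    by_cases hy : dist y x < ε
    · have : s ∈ 𝓝 y := mem_of_superset
        ((Metric.isOpen_ball (x := x) (ε := ε)).mem_nhds hy)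
        (Metric.ball_subset_closedBall.trans hεs)
      exact χ.contDiffAt.smul (hf.contDiffAt this)
    · have hev : (fun y => χ y • f y) =ᶠ[𝓝 y] fun _ => 0 := by
        have : {z | ε / 2 < dist z x} ∈ 𝓝 y :=
          (isOpen_lt continuous_const (by fun_prop)).mem_nhds (by
            have := not_lt.1 hy
            simp only [mem_ofPred_eq]; linarith)
        filter_upwards [this] with z hz
        rw [χ.zero_of_le_dist (le_of_lt hz), zero_smul]
      exact contDiffAt_const.congr_of_eventuallyEq hev
  · filter_upwards [χ.eventuallyEq_one] with y hy
    simp [hy]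

theorem injective_fderiv_of_leftInverse {f : E → F} {g : F → E} {x : E}
    (hf : DifferentiableAt ℝ f x) (hg : DifferentiableAt ℝ g (f x))
    (h : g ∘ f =ᶠ[𝓝 x] id) : Function.Injective (fderiv ℝ f x) := by
  have h1 := fderiv_comp x hg hf
  rw [h.fderiv_eq, fderiv_id] at h1
  intro a b hab
  have h2 : ∀ c, c = fderiv ℝ g (f x) (fderiv ℝ f x c) := fun c => congr($h1 c)
  rw [h2 a, h2 b, hab]

end Hadamard

end CuspSing
end

noncomputable section

namespace CuspSing

section SmulRight

variable {E F G : Type*} [NormedAddCommGroup E] [NormedSpace ℝ E] [NormedAddCommGroup F]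
  [NormedSpace ℝ F] [NormedAddCommGroup G] [NormedSpace ℝ G] {n : WithTop ℕ∞} {s : Set E}

theorem _root_.ContDiffOn.smul_smulRight {c : E → ℝ} (hc : ContDiffOn ℝ n c s)
    {m : E → F →L[ℝ] ℝ} {b : E → G} (hm : ContDiffOn ℝ n m s) (hb : ContDiffOn ℝ n b s) :
    ContDiffOn ℝ n (fun x => c x • (m x).smulRight (b x)) s := hc.smul (hm.smulRight hb)

end SmulRight

/-! ### The pulled-back metric in the ambient blown-up space. -/

section Ambient

variable {d : ℕ}

theorem contDiff_quadBlowDown : ContDiff ℝ ∞ (quadBlowDown d) := by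
  unfold quadBlowDown; fun_prop

theorem fderiv_quadBlowDown (w v : Coord d) :
    fderiv ℝ (quadBlowDown d) w v = (w.2 ^ 2 • v.1 + (2 * w.2 * v.2) • w.1, v.2) := by
  have h1 : HasFDerivAt (fun w : Coord d => w.1)
    (ContinuousLinearMap.fst ℝ (EuclideanSpace ℝ (Fin d)) ℝ) w := hasFDerivAt_fst
  have h2 : HasFDerivAt (fun w : Coord d => w.2)
    (ContinuousLinearMap.snd ℝ (EuclideanSpace ℝ (Fin d)) ℝ) w := hasFDerivAt_snd
  have h3 := ((h2.pow 2).smul h1).prodMk h2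
  have h4 : fderiv ℝ (quadBlowDown d) w = _ := h3.fderiv
  rw [h4]
  ext <;> simp

/-- Along the quadratic blowing-down map, a smooth function of `w` has a second order expansion
in `z` whose first two coefficients do not depend on `u`. -/
theorem exists_expansion_comp_quadBlowDown {F : Type*} [NormedAddCommGroup F] [NormedSpace ℝ F]
    [CompleteSpace F] {h : Coord d → F} (hh : ContDiff ℝ ∞ h) :
    ∃ (c : F) (R : Coord d → F), ContDiff ℝ ∞ R ∧ ∀ w,
      h (quadBlowDown d w) = h 0 + w.2 • c + w.2 ^ 2 • R w := by
  have hK : ContDiff ℝ ∞ (h ∘ quadBlowDown d) := hh.comp contDiff_quadBlowDown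
  obtain ⟨G, hG, hG1, hG2⟩ := exists_contDiff_hadamard hK
    (ContinuousLinearMap.snd ℝ (EuclideanSpace ℝ (Fin d)) ℝ) (0, 1)
  obtain ⟨R, hR, hR1, -⟩ := exists_contDiff_hadamard hG
    (ContinuousLinearMap.snd ℝ (EuclideanSpace ℝ (Fin d)) ℝ) (0, 1)
  refine ⟨fderiv ℝ h 0 (0, 1), R, hR, fun w => ?_⟩
  have hb : ∀ u : EuclideanSpace ℝ (Fin d), quadBlowDown d (u, 0) = 0 := fun u => by
    simp [quadBlowDown]
  -- On `{z = 0}` the derivative of the blow-down map keeps only the `z`-component, so the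
  -- first-order coefficient is the same for every `u`.
  have hG0 : ∀ u : EuclideanSpace ℝ (Fin d), G (u, 0) = fderiv ℝ h 0 (0, 1) := by
    intro u
    rw [hG2 (u, 0) rfl, fderiv_comp _ ((hh.differentiable (by simp)) _)
      ((contDiff_quadBlowDown.differentiable (by simp)) _)]
    simp [hb, fderiv_quadBlowDown]
  have e1 : w - w.2 • ((0, 1) : Coord d) = (w.1, 0) := by ext <;> simp
  have h1 := hG1 w
  have h2 := hR1 w
  simp only [ContinuousLinearMap.coe_snd', e1, Function.comp_apply, hb, hG0] at h1 h2
  rw [h1, h2, smul_add, smul_smul, pow_two, add_assoc]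

set_option maxHeartbeats 1000000 in
/-- In suitable coordinates the pullback of a metric under the quadratic blowing-down map has the
cusp form, with radial function `ρ`. -/
theorem exists_cuspForm_quadBlowDown {h : Coord d → Coord d →L[ℝ] Coord d →L[ℝ] ℝ}
    (hh : ContDiff ℝ ∞ h) (hsymm : ∀ v w, h 0 v w = h 0 w v) (hpos : ∀ v, v ≠ 0 → 0 < h 0 v v) :
    ∃ (ρ τ A : Coord d → ℝ) (B : Coord d → EuclideanSpace ℝ (Fin d) →L[ℝ] ℝ)
      (C : Coord d → EuclideanSpace ℝ (Fin d) →L[ℝ] EuclideanSpace ℝ (Fin d) →L[ℝ] ℝ)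
      (N : Set (Coord d)),
      ContDiff ℝ ∞ ρ ∧ ContDiff ℝ ∞ τ ∧ (∀ w, ρ w = w.2 * τ w) ∧
      IsOpen N ∧ (∀ u, ((u, 0) : Coord d) ∈ N) ∧ (∀ u, 0 < τ (u, 0)) ∧
      ContDiffOn ℝ ∞ A N ∧ ContDiffOn ℝ ∞ B N ∧ ContDiffOn ℝ ∞ C N ∧
      (∀ u a, a ≠ 0 → 0 < C (u, 0) a a) ∧
      ∀ w ∈ N, ∀ v : Coord d,
        h (quadBlowDown d w) (fderiv ℝ (quadBlowDown d) w v) (fderiv ℝ (quadBlowDown d) w v) =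
          (1 + w.2 ^ 2 * A w) * fderiv ℝ ρ w v ^ 2 +
            w.2 ^ 4 * (B w v.1 * fderiv ℝ ρ w v + C w v.1 v.1) := by
  obtain ⟨H₁, R, hR, hexp⟩ := exists_expansion_comp_quadBlowDown hh
  set H₀ := h 0 with hH₀
  set e : Coord d := (0, 1) with he
  obtain ⟨i, hi⟩ : ∃ i : EuclideanSpace ℝ (Fin d) →L[ℝ] Coord d, ∀ a, i a = (a, 0) :=
    ⟨ContinuousLinearMap.inl ℝ _ ℝ, fun a => rfl⟩
  obtain ⟨K, hKdef⟩ : ∃ K : Coord d → Coord d →L[ℝ] Coord d →L[ℝ] ℝ,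
    ∀ w, h (quadBlowDown d w) = K w := ⟨fun w => h (quadBlowDown d w), fun w => rfl⟩
  have hK : ContDiff ℝ ∞ K := by
    have := hh.comp (contDiff_quadBlowDown (d := d))
    simpa only [Function.comp_def, hKdef] using this
  simp only [hKdef] at hexp ⊢
  have hee : 0 < H₀ e e := hpos e (by simp [he])
  set α := √(H₀ e e) with hα
  have hα0 : 0 < α := Real.sqrt_pos.2 hee
  have hα2 : α ^ 2 = H₀ e e := Real.sq_sqrt hee.le
  -- The coefficients of `ρ` come from comparing `dρ²` with the pullback. Order `z` in `dz²` fixes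
  -- `β` and `lam`. Order `z²` in `dz du` requires the same `lam`, and order `z³` there fixes `mu`
  -- and `q`.
  let lam : EuclideanSpace ℝ (Fin d) →L[ℝ] ℝ := α⁻¹ • (H₀ e).comp i
  let β : ℝ := H₁ e e / (4 * α)
  let mu : EuclideanSpace ℝ (Fin d) →L[ℝ] ℝ :=
    α⁻¹ • ((1 / 2 : ℝ) • ((H₁ e).comp i + (H₁.flip e).comp i) - (2 * β) • lam)
  let q : EuclideanSpace ℝ (Fin d) →L[ℝ] EuclideanSpace ℝ (Fin d) →L[ℝ] ℝ :=
    α⁻¹ • (H₀.bilinearComp i i - lam.smulRight lam)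
  have hlam : ∀ a, α * lam a = H₀ e (i a) := fun a => by simp [lam]; field_simp
  have hβ : 4 * α * β = H₁ e e := by simp only [β]; field_simp
  have hmu : ∀ a, α * mu a = (H₁ e (i a) + H₁ (i a) e) / 2 - 2 * β * lam a := fun a => by
    simp [mu]; field_simp
  have hq : ∀ a b, α * q a b = H₀ (i a) (i b) - lam a * lam b := fun a b => by
    simp [q]; field_simp
  have hqs : ∀ a b, q a b = q b a := fun a b => by
    have := hq a b
    rw [hsymm, mul_comm (lam a), ← hq b a] at this
    exact mul_left_cancel₀ hα0.ne' this
  let n : Coord d → ℝ := fun w => q w.1 w.1 + mu w.1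
  -- With these, `dρ = ρz dz + z² m(du)`.
  let ρz : Coord d → ℝ := fun w => α + w.2 * (2 * β + 2 * lam w.1) + 3 * w.2 ^ 2 * n w
  let m : Coord d → EuclideanSpace ℝ (Fin d) →L[ℝ] ℝ := fun w => lam + w.2 • (2 • q w.1 + mu)
  let τ : Coord d → ℝ := fun w => α + w.2 * (β + lam w.1) + w.2 ^ 2 * n w
  let ρ : Coord d → ℝ := fun w => w.2 * τ w
  -- `z² A₀` and `z⁴ B₀` are what is left of the `dz²` and `dz du` coefficients after subtracting
  -- those of `dρ²`.
  let A₀ : Coord d → ℝ := fun w => R w e e + 2 * (H₁ e (i w.1) + H₁ (i w.1) e)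
    + 2 * w.2 * (R w e (i w.1) + R w (i w.1) e)
    + 4 * K w (i w.1) (i w.1) - (2 * β + 2 * lam w.1) ^ 2 - 6 * α * n w
    - 6 * w.2 * n w * (2 * β + 2 * lam w.1) - 9 * w.2 ^ 2 * n w ^ 2
  let s : (Coord d →L[ℝ] Coord d →L[ℝ] ℝ) → Coord d → EuclideanSpace ℝ (Fin d) →L[ℝ] ℝ :=
    fun K x => (K x).comp i + (K.flip x).comp i
  let B₀ : Coord d → EuclideanSpace ℝ (Fin d) →L[ℝ] ℝ := fun w =>
    s (R w) e + (2 : ℝ) • s H₁ (i w.1) + (2 * w.2) • s (R w) (i w.1)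
      - (2 * (2 * β + 2 * lam w.1)) • (2 • q w.1 + mu) - (6 * n w) • lam
      - (6 * n w * w.2) • (2 • q w.1 + mu)
  have hn : ContDiff ℝ ∞ n := by simp only [n]; fun_prop
  have hρz : ContDiff ℝ ∞ ρz := by simp only [ρz]; fun_prop
  have hm : ContDiff ℝ ∞ m := by simp only [m]; fun_prop
  have hτ : ContDiff ℝ ∞ τ := by simp only [τ]; fun_prop
  have hA₀ : ContDiff ℝ ∞ A₀ := by simp only [A₀]; fun_prop
  have hB₀ : ContDiff ℝ ∞ B₀ := by
    rw [contDiff_clm_apply_iff]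
    intro a
    simp [B₀, s]
    fun_prop
  have hKC : ContDiff ℝ ∞ (fun w => (K w).bilinearComp i i) := by
    rw [contDiff_clm_apply_iff]
    intro a
    rw [contDiff_clm_apply_iff]
    intro b
    simp only [ContinuousLinearMap.bilinearComp_apply]
    fun_prop
  have hρ' : ∀ w v, fderiv ℝ ρ w v = ρz w * v.2 + w.2 ^ 2 * m w v.1 := by
    intro w v
    have h1 : HasFDerivAt (fun w : Coord d => w.1)
      (ContinuousLinearMap.fst ℝ (EuclideanSpace ℝ (Fin d)) ℝ) w := hasFDerivAt_fst
    have h2 : HasFDerivAt (fun w : Coord d => w.2)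
      (ContinuousLinearMap.snd ℝ (EuclideanSpace ℝ (Fin d)) ℝ) w := hasFDerivAt_snd
    have hl : HasFDerivAt (fun w : Coord d => lam w.1) _ w := lam.hasFDerivAt.comp w h1
    have hmm : HasFDerivAt (fun w : Coord d => mu w.1) _ w := mu.hasFDerivAt.comp w h1
    have hqq : HasFDerivAt (fun w : Coord d => q w.1 w.1) _ w :=
      (q.hasFDerivAt.comp w h1).clm_apply h1
    have hall : HasFDerivAt ρ _ w :=
      h2.mul (((hasFDerivAt_const α w).add (h2.mul ((hasFDerivAt_const β w).add hl))).add
        ((h2.pow 2).mul (hqq.add hmm)))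
    rw [hall.fderiv]
    simp [ρz, m, n, hqs v.1 w.1]
    ring
  have key : ∀ w v, K w (fderiv ℝ (quadBlowDown d) w v)
      (fderiv ℝ (quadBlowDown d) w v) = fderiv ℝ ρ w v ^ 2 + w.2 ^ 2 * A₀ w * v.2 ^ 2 +
        w.2 ^ 4 * (B₀ w v.1 * v.2 +
          (K w (i v.1) (i v.1) - m w v.1 * m w v.1)) := by
    intro w v
    have e1 : fderiv ℝ (quadBlowDown d) w v =
        v.2 • e + (2 * w.2 * v.2) • i w.1 + w.2 ^ 2 • i v.1 := by
      rw [fderiv_quadBlowDown]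
      ext <;> simp [he, hi, add_comm]
    rw [e1, hρ', hexp]
    have l1 := hlam w.1
    have l2 := hlam v.1
    have l3 := hmu w.1
    have l4 := hmu v.1
    have l5 := hq w.1 w.1
    have l6 := hq w.1 v.1
    have s1 := hsymm (i w.1) e
    have s2 := hsymm (i v.1) e
    have s3 := hsymm (i v.1) (i w.1)
    simp only [A₀, B₀, s, ρz, m, n, hexp, map_add, map_smul, add_apply,
      smul_apply, sub_apply, smul_eq_mul,
      ContinuousLinearMap.comp_apply, ContinuousLinearMap.flip_apply, s1, s2, s3, nsmul_eq_mul,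
      Nat.cast_ofNat]
    have t1 : H₀ (i w.1) (i w.1) = α * q w.1 w.1 + lam w.1 * lam w.1 := by linarith
    have t2 : H₀ (i w.1) (i v.1) = α * q w.1 v.1 + lam w.1 * lam v.1 := by linarith
    have t3 : H₁ (i w.1) e = 2 * (α * mu w.1 + 2 * β * lam w.1) - H₁ e (i w.1) := by linarith
    have t4 : H₁ (i v.1) e = 2 * (α * mu v.1 + 2 * β * lam v.1) - H₁ e (i v.1) := by linarith
    rw [t1, t2, t3, t4, ← l1, ← l2, ← hα2, ← hβ]
    ring
  have hopen : IsOpen {w | ρz w ≠ 0} := isOpen_ne_fun hρz.continuous continuous_const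
  have hinv : ContDiffOn ℝ ∞ (fun w => (ρz w)⁻¹) {w | ρz w ≠ 0} :=
    hρz.contDiffOn.inv fun w hw => hw
  -- These coefficients result from substituting `dz = (dρ - z² m(du)) / ρz` into `key`, which is
  -- legitimate where `ρz ≠ 0`.
  refine ⟨ρ, τ, fun w => A₀ w * (ρz w)⁻¹ ^ 2,
    fun w => (ρz w)⁻¹ • B₀ w - (2 * A₀ w * (ρz w)⁻¹ ^ 2) • m w,
    fun w => (K w).bilinearComp i i - (m w).smulRight (m w)
      + (w.2 ^ 2 * A₀ w * (ρz w)⁻¹ ^ 2) • (m w).smulRight (m w)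
      - (w.2 ^ 2 * (ρz w)⁻¹) • (m w).smulRight (B₀ w),
    {w | ρz w ≠ 0}, contDiff_snd.mul hτ, hτ, fun w => rfl, hopen, ?_, ?_, ?_, ?_, ?_, ?_, ?_⟩
  · intro u
    simpa [ρz] using hα0.ne'
  · intro u
    simpa [τ] using hα0
  · exact hA₀.contDiffOn.mul (hinv.pow 2)
  · exact (hinv.smul hB₀.contDiffOn).sub
      (((contDiff_const.mul hA₀).contDiffOn.mul (hinv.pow 2)).smul hm.contDiffOn)
  · have hz : ContDiff ℝ ∞ fun w : Coord d => w.2 ^ 2 := by fun_prop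
    exact ((hKC.contDiffOn.sub (hm.contDiffOn.smulRight hm.contDiffOn)).add
      (((hz.mul hA₀).contDiffOn.mul (hinv.pow 2)).smul_smulRight hm.contDiffOn hm.contDiffOn)).sub
      ((hz.contDiffOn.mul hinv).smul_smulRight hm.contDiffOn hB₀.contDiffOn)
  · intro u a ha
    have hb : K (u, 0) = H₀ := by
      rw [← hKdef, show quadBlowDown d (u, 0) = 0 by simp [quadBlowDown]]
    -- This vector is the `H₀`-orthogonal projection of `i a` off `e`. Its squared length is `H₀ (i
    -- a) (i a) - lam a ^ 2`, the value of `C` at `z = 0`.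
    have hne : i a - (lam a / α) • e ≠ 0 := fun h0 => ha (by
      simpa [hi, he] using congr($h0.1))
    have h1 := hpos _ hne
    have h2 : H₀ e (i a) = α * lam a := (hlam a).symm
    have h3 : H₀ (i a) e = α * lam a := by rw [hsymm, h2]
    simp only [map_sub, map_smul, sub_apply, smul_apply,
      smul_eq_mul, h2, h3, ← hα2] at h1
    simp [hb, m]
    have h4 : lam a / α * (α * lam a) = lam a * lam a := by field_simp
    have h5 : lam a / α * (lam a / α * α ^ 2) = lam a * lam a := by field_simp
    linarith
  · intro w hw v
    rw [key, hρ']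
    simp only [add_apply, smul_apply,
      sub_apply, smul_eq_mul, ContinuousLinearMap.bilinearComp_apply,
      ContinuousLinearMap.smulRight_apply]
    have hw' : ρz w ≠ 0 := hw
    field_simp
    ring

end Ambient

end CuspSing
end

noncomputable section

namespace CuspSing

/-! ### Coordinate changes of the half-space. -/

section HalfSpace

open Set

variable {k : ℕ}

/-- The first unit vector, which points into the half-space. -/
def inwardVector (k : ℕ) : EuclideanSpace ℝ (Fin (k + 1)) := EuclideanSpace.single 0 1

@[simp] theorem inwardVector_zero : inwardVector k 0 = 1 := by simp [inwardVector]

theorem norm_sub_inwardVector_le (y : EuclideanSpace ℝ (Fin (k + 1))) :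
    ‖y - y 0 • inwardVector k‖ ≤ ‖y‖ := by
  rw [EuclideanSpace.norm_eq, EuclideanSpace.norm_eq]
  apply Real.sqrt_le_sqrt
  refine Finset.sum_le_sum fun i _ => ?_
  refine Fin.cases ?_ (fun i => ?_) i <;> simp [inwardVector, sq_nonneg]

theorem sub_inwardVector_mem_ball {y₀ y : EuclideanSpace ℝ (Fin (k + 1))} {δ : ℝ}
    (hy₀ : y₀ 0 = 0) (hy : y ∈ Metric.ball y₀ δ) :
    y - y 0 • inwardVector k ∈ Metric.ball y₀ δ := by
  rw [mem_ball_iff_norm] at hy ⊢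
  have := norm_sub_inwardVector_le (y - y₀)
  simp only [PiLp.sub_apply, hy₀, sub_zero] at this
  rw [sub_right_comm]
  exact this.trans_lt hy

/-- Replacing the first coordinate by a function which vanishes on the boundary of the half-space
and has positive inward derivative there is a local diffeomorphism preserving the half-space. -/
theorem exists_halfSpace_coordinate_change {R : EuclideanSpace ℝ (Fin (k + 1)) → ℝ}
    {O : Set (EuclideanSpace ℝ (Fin (k + 1)))} (hO : IsOpen O) (hR : ContDiffOn ℝ ∞ R O)
    {y₀ : EuclideanSpace ℝ (Fin (k + 1))} (hy₀ : y₀ ∈ O) (hy₀0 : y₀ 0 = 0)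
    (hR0 : ∀ y ∈ O, y 0 = 0 → R y = 0) (hRpos : 0 < fderiv ℝ R y₀ (inwardVector k)) :
    ∃ Ψ : OpenPartialHomeomorph (EuclideanSpace ℝ (Fin (k + 1))) (EuclideanSpace ℝ (Fin (k + 1))),
      y₀ ∈ Ψ.source ∧ Ψ.source ⊆ O ∧ ContDiffOn ℝ ∞ Ψ Ψ.source ∧
      ContDiffOn ℝ ∞ Ψ.symm Ψ.target ∧ (∀ y ∈ Ψ.source, Ψ y 0 = R y) ∧
      ∀ y ∈ Ψ.source, 0 ≤ y 0 ↔ 0 ≤ Ψ y 0 := by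
  let l : EuclideanSpace ℝ (Fin (k + 1)) →L[ℝ] ℝ := EuclideanSpace.proj 0
  -- Only the first coordinate is changed, to `R`. The derivative of `f` is thus injective wherever
  -- the inward derivative of `R` is nonzero.
  let f : EuclideanSpace ℝ (Fin (k + 1)) → EuclideanSpace ℝ (Fin (k + 1)) :=
    fun y => y + (R y - l y) • inwardVector k
  have hf0 : ∀ y, f y 0 = R y := fun y => by simp [f, l]
  have hcont : ContinuousOn (fun y => fderiv ℝ R y (inwardVector k)) O :=
    (hR.continuousOn_fderiv_of_isOpen hO (by simp)).clm_apply continuousOn_const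
  obtain ⟨δ, hδ, hball⟩ : ∃ δ > 0, Metric.ball y₀ δ ⊆
      O ∩ {y | 0 < fderiv ℝ R y (inwardVector k)} := by
    apply Metric.mem_nhds_iff.1
    exact inter_mem (hO.mem_nhds hy₀)
      ((hcont.continuousAt (hO.mem_nhds hy₀)).eventually (lt_mem_nhds hRpos))
  have hd : ∀ y ∈ Metric.ball y₀ δ, ∃ D : EuclideanSpace ℝ (Fin (k + 1)) ≃L[ℝ]
      EuclideanSpace ℝ (Fin (k + 1)), HasFDerivAt f (D : _ →L[ℝ] _) y := by
    intro y hy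
    have h1 : DifferentiableAt ℝ R y :=
      (hR.contDiffAt (hO.mem_nhds (hball hy).1)).differentiableAt (by simp)
    have h2 : HasFDerivAt f (ContinuousLinearMap.id ℝ _ +
        (fderiv ℝ R y - l).smulRight (inwardVector k)) y :=
      (hasFDerivAt_id y).add ((h1.hasFDerivAt.sub l.hasFDerivAt).smul_const _)
    set D := ContinuousLinearMap.id ℝ _ + (fderiv ℝ R y - l).smulRight (inwardVector k) with hD
    have hinj : Function.Injective D := by
      rw [injective_iff_map_eq_zero]
      intro v hv
      have h3 : v = (l v - fderiv ℝ R y v) • inwardVector k := by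
        rw [← sub_eq_zero, ← hv]
        simp only [hD, add_apply, ContinuousLinearMap.id_apply,
          ContinuousLinearMap.smulRight_apply, sub_apply]
        module
      have h4 : l v = l v - fderiv ℝ R y v := by
        have := congr($h3 0)
        simpa [l] using this
      have h5 : fderiv ℝ R y v = 0 := by linarith
      rw [h5, sub_zero] at h3
      rw [h3, map_smul, smul_eq_mul] at h5
      rcases mul_eq_zero.1 h5 with h6 | h6
      · rw [h3, h6, zero_smul]
      · exact absurd h6 (hball hy).2.ne'
    refine ⟨(LinearEquiv.ofInjectiveEndo D.toLinearMap hinj).toContinuousLinearEquiv, ?_⟩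
    convert h2 using 1
    ext v
    rfl
  have hfsm : ContDiffOn ℝ ∞ f O :=
    contDiffOn_id.add ((hR.sub l.contDiff.contDiffOn).smul contDiffOn_const)
  have hfAt : ∀ y ∈ Metric.ball y₀ δ, ContDiffAt ℝ ∞ f y := fun y hy =>
    hfsm.contDiffAt (hO.mem_nhds (hball hy).1)
  have hyb := Metric.mem_ball_self (x := y₀) hδ
  obtain ⟨D₀, hD₀⟩ := hd y₀ hyb
  let Ψ := ((hfAt y₀ hyb).toOpenPartialHomeomorph f hD₀ (by simp)).restrOpen (Metric.ball y₀ δ)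
    Metric.isOpen_ball
  have hΨ : ∀ y, Ψ y = f y := fun y => rfl
  have hΨs : Ψ.source ⊆ Metric.ball y₀ δ := fun y hy => hy.2
  refine ⟨Ψ, ⟨(hfAt y₀ hyb).mem_toOpenPartialHomeomorph_source hD₀ (by simp), hyb⟩,
    fun y hy => (hball (hΨs hy)).1, fun y hy => (hfAt y (hΨs hy)).contDiffWithinAt, ?_, ?_, ?_⟩
  · intro z hz
    obtain ⟨D, hD⟩ := hd _ (hΨs (Ψ.map_target hz))
    exact (Ψ.contDiffAt_symm hz hD (hfAt _ (hΨs (Ψ.map_target hz)))).contDiffWithinAt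
  · intro y _
    exact hf0 y
  · intro y hy
    rw [hΨ, hf0]
    have hy' := hΨs hy
    have hp := sub_inwardVector_mem_ball hy₀0 hy'
    -- The segment from the projection of `y` to `{y 0 = 0}`, where `R` vanishes, up to `y` stays in
    -- the ball. Hence `R y` is `y 0` times a positive derivative and has the same sign.
    obtain ⟨z, hz, hz'⟩ := domain_mvt (f := R) (f' := fderiv ℝ R) (s := Metric.ball y₀ δ)
      (fun x hx => ((hR.contDiffAt (hO.mem_nhds (hball hx).1)).differentiableAt
        (by simp)).hasFDerivAt.hasFDerivWithinAt) (convex_ball _ _) hp hy'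
    have hzb := (convex_ball y₀ δ).segment_subset hp hy' hz
    rw [hR0 _ (hball hp).1 (by simp), sub_sub_cancel, sub_zero, map_smul, smul_eq_mul] at hz'
    rw [hz']
    exact (mul_nonneg_iff_of_pos_right (hball hzb).2).symm

/-- A homeomorphism between open subsets of Euclidean space which preserves the half-space,
restricted to the half-space. -/
def halfSpaceRestr
    (Ψ : OpenPartialHomeomorph (EuclideanSpace ℝ (Fin (k + 1))) (EuclideanSpace ℝ (Fin (k + 1))))
    (hΨ : ∀ y ∈ Ψ.source, 0 ≤ y 0 ↔ 0 ≤ Ψ y 0) :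
    OpenPartialHomeomorph (EuclideanHalfSpace (k + 1)) (EuclideanHalfSpace (k + 1)) where
  toFun x := (𝓡∂ (k + 1)).symm (Ψ ((𝓡∂ (k + 1)) x))
  invFun x := (𝓡∂ (k + 1)).symm (Ψ.symm ((𝓡∂ (k + 1)) x))
  source := (𝓡∂ (k + 1)) ⁻¹' Ψ.source
  target := (𝓡∂ (k + 1)) ⁻¹' Ψ.target
  map_source' x hx := by
    have h1 : Ψ ((𝓡∂ (k + 1)) x) ∈ range (𝓡∂ (k + 1)) := by
      rw [range_modelWithCornersEuclideanHalfSpace]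
      exact (hΨ _ hx).1 x.2
    rw [mem_preimage, (𝓡∂ (k + 1)).right_inv h1]
    exact Ψ.map_source hx
  map_target' x hx := by
    have h1 : Ψ.symm ((𝓡∂ (k + 1)) x) ∈ range (𝓡∂ (k + 1)) := by
      rw [range_modelWithCornersEuclideanHalfSpace]
      refine (hΨ _ (Ψ.map_target hx)).2 ?_
      rw [Ψ.right_inv hx]
      exact x.2
    rw [mem_preimage, (𝓡∂ (k + 1)).right_inv h1]
    exact Ψ.map_target hx
  left_inv' x hx := by
    have h1 : Ψ ((𝓡∂ (k + 1)) x) ∈ range (𝓡∂ (k + 1)) := by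
      rw [range_modelWithCornersEuclideanHalfSpace]
      exact (hΨ _ hx).1 x.2
    rw [(𝓡∂ (k + 1)).right_inv h1, Ψ.left_inv hx, (𝓡∂ (k + 1)).left_inv]
  right_inv' x hx := by
    have h1 : Ψ.symm ((𝓡∂ (k + 1)) x) ∈ range (𝓡∂ (k + 1)) := by
      rw [range_modelWithCornersEuclideanHalfSpace]
      refine (hΨ _ (Ψ.map_target hx)).2 ?_
      rw [Ψ.right_inv hx]
      exact x.2
    rw [(𝓡∂ (k + 1)).right_inv h1, Ψ.right_inv hx, (𝓡∂ (k + 1)).left_inv]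
  open_source := Ψ.open_source.preimage (𝓡∂ (k + 1)).continuous
  open_target := Ψ.open_target.preimage (𝓡∂ (k + 1)).continuous
  continuousOn_toFun := (𝓡∂ (k + 1)).continuous_symm.comp_continuousOn
    (Ψ.continuousOn.comp (𝓡∂ (k + 1)).continuous.continuousOn fun _ h => h)
  continuousOn_invFun := (𝓡∂ (k + 1)).continuous_symm.comp_continuousOn
    (Ψ.symm.continuousOn.comp (𝓡∂ (k + 1)).continuous.continuousOn fun _ h => h)

theorem model_halfSpaceRestr
    {Ψ : OpenPartialHomeomorph (EuclideanSpace ℝ (Fin (k + 1))) (EuclideanSpace ℝ (Fin (k + 1)))}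
    (hΨ : ∀ y ∈ Ψ.source, 0 ≤ y 0 ↔ 0 ≤ Ψ y 0) {x : EuclideanHalfSpace (k + 1)}
    (hx : (𝓡∂ (k + 1)) x ∈ Ψ.source) :
    (𝓡∂ (k + 1)) (halfSpaceRestr Ψ hΨ x) = Ψ ((𝓡∂ (k + 1)) x) := by
  apply (𝓡∂ (k + 1)).right_inv
  rw [range_modelWithCornersEuclideanHalfSpace]
  exact (hΨ _ hx).1 x.2

theorem contMDiffOn_halfSpaceRestr
    {Ψ : OpenPartialHomeomorph (EuclideanSpace ℝ (Fin (k + 1))) (EuclideanSpace ℝ (Fin (k + 1)))}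
    (hΨ : ∀ y ∈ Ψ.source, 0 ≤ y 0 ↔ 0 ≤ Ψ y 0) (hs : ContDiffOn ℝ ∞ Ψ Ψ.source)
    (ht : ContDiffOn ℝ ∞ Ψ.symm Ψ.target) :
    ContMDiffOn (𝓡∂ (k + 1)) (𝓡∂ (k + 1)) ∞ (halfSpaceRestr Ψ hΨ) (halfSpaceRestr Ψ hΨ).source ∧
    ContMDiffOn (𝓡∂ (k + 1)) (𝓡∂ (k + 1)) ∞ (halfSpaceRestr Ψ hΨ).symm
      (halfSpaceRestr Ψ hΨ).target := by
  constructor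
  · refine ((𝓡∂ (k + 1)).contMDiffOn_symm (n := ∞)).comp
      (hs.contMDiffOn.comp ((𝓡∂ (k + 1)).contMDiff (n := ∞)).contMDiffOn fun _ h => h) ?_
    intro x hx
    rw [mem_preimage, range_modelWithCornersEuclideanHalfSpace]
    exact (hΨ _ hx).1 x.2
  · refine ((𝓡∂ (k + 1)).contMDiffOn_symm (n := ∞)).comp
      (ht.contMDiffOn.comp ((𝓡∂ (k + 1)).contMDiff (n := ∞)).contMDiffOn fun _ h => h) ?_
    intro x hx
    rw [mem_preimage, range_modelWithCornersEuclideanHalfSpace]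
    refine (hΨ _ (Ψ.map_target hx)).2 ?_
    rw [Ψ.right_inv hx]
    exact x.2

variable {M : Type*} [TopologicalSpace M] [ChartedSpace (EuclideanHalfSpace (k + 1)) M]

theorem trans_halfSpaceRestr_mem_maximalAtlas [IsManifold (𝓡∂ (k + 1)) ∞ M]
    {φ : OpenPartialHomeomorph M (EuclideanHalfSpace (k + 1))}
    (hφ : φ ∈ IsManifold.maximalAtlas (𝓡∂ (k + 1)) ∞ M)
    {Ψ : OpenPartialHomeomorph (EuclideanSpace ℝ (Fin (k + 1))) (EuclideanSpace ℝ (Fin (k + 1)))}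
    (hΨ : ∀ y ∈ Ψ.source, 0 ≤ y 0 ↔ 0 ≤ Ψ y 0) (hs : ContDiffOn ℝ ∞ Ψ Ψ.source)
    (ht : ContDiffOn ℝ ∞ Ψ.symm Ψ.target) :
    φ.trans (halfSpaceRestr Ψ hΨ) ∈ IsManifold.maximalAtlas (𝓡∂ (k + 1)) ∞ M := by
  obtain ⟨h1, h2⟩ := contMDiffOn_halfSpaceRestr hΨ hs ht
  apply OpenPartialHomeomorph.mem_maximalAtlas_of_contMDiffOn
  · exact h1.comp ((contMDiffOn_of_mem_maximalAtlas hφ).mono fun x hx => hx.1) fun x hx => hx.2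
  · exact (contMDiffOn_symm_of_mem_maximalAtlas hφ).comp (h2.mono fun x hx => hx.1)
      fun x hx => hx.2

/-- In every chart of the maximal atlas the interior is where the first coordinate is positive. -/
theorem isInteriorPoint_iff_of_mem_maximalAtlas
    {φ : OpenPartialHomeomorph M (EuclideanHalfSpace (k + 1))}
    (hφ : φ ∈ IsManifold.maximalAtlas (𝓡∂ (k + 1)) ∞ M) {x : M} (hx : x ∈ φ.source) :
    (𝓡∂ (k + 1)).IsInteriorPoint x ↔ 0 < φ.extend (𝓡∂ (k + 1)) x 0 := by
  -- A chart is a local diffeomorphism onto the model, and these preserve interior points.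
  have hloc : IsLocalDiffeomorphAt (𝓡∂ (k + 1)) (𝓡∂ (k + 1)) ∞ φ x :=
    ⟨{ toPartialEquiv := φ.toPartialEquiv
       open_source := φ.open_source
       open_target := φ.open_target
       contMDiffOn_toFun := contMDiffOn_of_mem_maximalAtlas hφ
       contMDiffOn_invFun := contMDiffOn_symm_of_mem_maximalAtlas hφ }, hx, fun _ _ => rfl⟩
  rw [hloc.isInteriorPoint_iff (by simp), ModelWithCorners.IsInteriorPoint, extChartAt_self_apply,
    interior_range_modelWithCornersEuclideanHalfSpace]
  rfl

end HalfSpace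

end CuspSing
end

noncomputable section

namespace CuspSing

/-! ### Local parametrizations of the resolution and its boundary charts. -/

section Parametrization

open Set

variable {d k : ℕ} {Y : Set (Coord d)} [ChartedSpace (EuclideanHalfSpace (k + 1)) Y]

/-- The inverse of the chart `φ` of the submanifold `Y` extends to a smooth map `ι` on an open
subset `O` of Euclidean space, with differentiable left inverse `L`. -/
structure IsParametrization (φ : OpenPartialHomeomorph Y (EuclideanHalfSpace (k + 1)))
    (O : Set (EuclideanSpace ℝ (Fin (k + 1)))) (ι : EuclideanSpace ℝ (Fin (k + 1)) → Coord d)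
    (L : Coord d → EuclideanSpace ℝ (Fin (k + 1))) : Prop where
  mem_maximalAtlas : φ ∈ IsManifold.maximalAtlas (𝓡∂ (k + 1)) ∞ Y
  isOpen : IsOpen O
  target_subset : (φ.extend (𝓡∂ (k + 1))).target ⊆ O
  contDiffOn : ContDiffOn ℝ ∞ ι O
  differentiableAt_leftInv : ∀ y ∈ O, DifferentiableAt ℝ L (ι y)
  leftInv : ∀ y ∈ O, L (ι y) = y
  apply_extend : ∀ x ∈ φ.source, ι (φ.extend (𝓡∂ (k + 1)) x) = x

namespace IsParametrization

variable {φ : OpenPartialHomeomorph Y (EuclideanHalfSpace (k + 1))}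
  {O : Set (EuclideanSpace ℝ (Fin (k + 1)))} {ι : EuclideanSpace ℝ (Fin (k + 1)) → Coord d}
  {L : Coord d → EuclideanSpace ℝ (Fin (k + 1))}

theorem extend_mem_target {M : Type*} [TopologicalSpace M]
    {φ : OpenPartialHomeomorph M (EuclideanHalfSpace (k + 1))} {x : M} (hx : x ∈ φ.source) :
    φ.extend (𝓡∂ (k + 1)) x ∈ (φ.extend (𝓡∂ (k + 1))).target :=
  (φ.extend _).map_source (by rwa [φ.extend_source])

theorem extend_mem (h : IsParametrization φ O ι L) {x : Y} (hx : x ∈ φ.source) :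
    φ.extend (𝓡∂ (k + 1)) x ∈ O := h.target_subset (extend_mem_target hx)

theorem contDiffAt (h : IsParametrization φ O ι L) {y : EuclideanSpace ℝ (Fin (k + 1))}
    (hy : y ∈ O) : ContDiffAt ℝ ∞ ι y := h.contDiffOn.contDiffAt (h.isOpen.mem_nhds hy)

theorem differentiableAt (h : IsParametrization φ O ι L) {y : EuclideanSpace ℝ (Fin (k + 1))}
    (hy : y ∈ O) : DifferentiableAt ℝ ι y := (h.contDiffAt hy).differentiableAt (by simp)

theorem injective_fderiv (h : IsParametrization φ O ι L) {y : EuclideanSpace ℝ (Fin (k + 1))}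
    (hy : y ∈ O) : Function.Injective (fderiv ℝ ι y) :=
  injective_fderiv_of_leftInverse (h.differentiableAt hy) (h.differentiableAt_leftInv y hy)
    (by filter_upwards [h.isOpen.mem_nhds hy] with z hz using h.leftInv z hz)

theorem mfderiv_comp_val (h : IsParametrization φ O ι L) {F : Type*} [NormedAddCommGroup F]
    [NormedSpace ℝ F] {f : Coord d → F} {x : Y} (hx : x ∈ φ.source)
    (hf : DifferentiableAt ℝ f x) (v : TangentSpace (𝓡∂ (k + 1)) x) :
    mfderiv (𝓡∂ (k + 1)) 𝓘(ℝ, F) (fun x : Y => f x) x v =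
      fderiv ℝ f x (fderiv ℝ ι (φ.extend (𝓡∂ (k + 1)) x)
        (mfderiv (𝓡∂ (k + 1)) 𝓘(ℝ, EuclideanSpace ℝ (Fin (k + 1)))
          (φ.extend (𝓡∂ (k + 1))) x v)) := by
  have hev : (fun x : Y => f x) =ᶠ[𝓝 x] (f ∘ ι) ∘ φ.extend (𝓡∂ (k + 1)) := by
    filter_upwards [φ.open_source.mem_nhds hx] with z hz
    rw [Function.comp_apply, Function.comp_apply, h.apply_extend z hz]
  have hι := h.differentiableAt (h.extend_mem hx)
  have hf' : DifferentiableAt ℝ f (ι (φ.extend (𝓡∂ (k + 1)) x)) := by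
    rwa [h.apply_extend x hx]
  have hφ : MDifferentiableAt (𝓡∂ (k + 1)) 𝓘(ℝ, EuclideanSpace ℝ (Fin (k + 1)))
      (φ.extend (𝓡∂ (k + 1))) x :=
    (φ.contMDiffAt_extend h.mem_maximalAtlas hx).mdifferentiableAt (by simp)
  rw [hev.mfderiv_eq, mfderiv_comp x (hf'.comp _ hι).mdifferentiableAt hφ, mfderiv_eq_fderiv,
    fderiv_comp _ hf' hι, h.apply_extend x hx]
  rfl

theorem mfderiv_val (h : IsParametrization φ O ι L) {x : Y} (hx : x ∈ φ.source)
    (v : TangentSpace (𝓡∂ (k + 1)) x) :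
    mfderiv (𝓡∂ (k + 1)) 𝓘(ℝ, Coord d) (Subtype.val : Y → Coord d) x v =
      fderiv ℝ ι (φ.extend (𝓡∂ (k + 1)) x)
        (mfderiv (𝓡∂ (k + 1)) 𝓘(ℝ, EuclideanSpace ℝ (Fin (k + 1)))
          (φ.extend (𝓡∂ (k + 1))) x v) := by
  have := h.mfderiv_comp_val (f := id) hx differentiableAt_id v
  rw [fderiv_id] at this
  exact this

theorem injective_mfderiv_extend [IsManifold (𝓡∂ (k + 1)) ∞ Y] (h : IsParametrization φ O ι L)
    {x : Y} (hx : x ∈ φ.source) :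
    Function.Injective (mfderiv (𝓡∂ (k + 1)) 𝓘(ℝ, EuclideanSpace ℝ (Fin (k + 1)))
      (φ.extend (𝓡∂ (k + 1))) x) := by
  have h1 : φ.MDifferentiable (𝓡∂ (k + 1)) (𝓡∂ (k + 1)) :=
    ⟨(contMDiffOn_of_mem_maximalAtlas h.mem_maximalAtlas).mdifferentiableOn (by simp),
      (contMDiffOn_symm_of_mem_maximalAtlas h.mem_maximalAtlas).mdifferentiableOn (by simp)⟩
  have h2 := (𝓡∂ (k + 1)).hasMFDerivAt (x := φ x)
  have h3 := h2.comp x (h1.mdifferentiableAt hx).hasMFDerivAt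
  have h4 : mfderiv (𝓡∂ (k + 1)) 𝓘(ℝ, EuclideanSpace ℝ (Fin (k + 1)))
      (φ.extend (𝓡∂ (k + 1))) x = _ := h3.mfderiv
  rw [h4]
  exact h1.mfderiv_injective hx

theorem exists_restr [IsManifold (𝓡∂ (k + 1)) ∞ Y] (h : IsParametrization φ O ι L)
    {x : Y} (hx : x ∈ φ.source)
    {V : Set (EuclideanSpace ℝ (Fin (k + 1)))} (hV : IsOpen V)
    (hxV : φ.extend (𝓡∂ (k + 1)) x ∈ V) :
    ∃ φ' : OpenPartialHomeomorph Y (EuclideanHalfSpace (k + 1)), x ∈ φ'.source ∧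
      φ'.extend (𝓡∂ (k + 1)) x = φ.extend (𝓡∂ (k + 1)) x ∧ IsParametrization φ' (O ∩ V) ι L := by
  have hs : IsOpen (φ.source ∩ φ.extend (𝓡∂ (k + 1)) ⁻¹' V) :=
    ContinuousOn.isOpen_inter_preimage
      (by simpa only [φ.extend_source] using φ.continuousOn_extend (I := 𝓡∂ (k + 1)))
      φ.open_source hV
  have hsub : (φ.restr (φ.source ∩ φ.extend (𝓡∂ (k + 1)) ⁻¹' V)).source ⊆
      φ.source ∩ φ.extend (𝓡∂ (k + 1)) ⁻¹' V := by
    rw [φ.restr_source' _ hs]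
    exact inter_subset_right
  refine ⟨φ.restr (φ.source ∩ φ.extend (𝓡∂ (k + 1)) ⁻¹' V), ?_, rfl, ?_⟩
  · rw [φ.restr_source' _ hs]
    exact ⟨hx, hx, hxV⟩
  · refine ⟨restr_mem_maximalAtlas _ h.mem_maximalAtlas hs, h.isOpen.inter hV, ?_,
      h.contDiffOn.mono inter_subset_left, fun y hy => h.differentiableAt_leftInv y hy.1,
      fun y hy => h.leftInv y hy.1, fun z hz => h.apply_extend z (hsub hz).1⟩
    rw [OpenPartialHomeomorph.extend_target_eq_image_source]
    rintro _ ⟨z, hz, rfl⟩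
    exact ⟨h.extend_mem (hsub hz).1, (hsub hz).2⟩

end IsParametrization

/-- By the normal form of an immersion, the inclusion read in suitable charts is a linear injection
`j`. It is defined on the whole Euclidean space, so the inverse chart extends smoothly across the
boundary; the left inverse is the first component of the inverse of the splitting. -/
theorem exists_isParametrization
    (hY : Manifold.IsSmoothEmbedding (𝓡∂ (k + 1)) 𝓘(ℝ, Coord d) ∞ (Subtype.val : Y → Coord d))
    (x : Y) :
    ∃ φ O ι L, x ∈ φ.source ∧ IsParametrization (Y := Y) (k := k) φ O ι L := by
  have h := hY.isImmersion.isImmersionAt x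
  have hψ := contMDiffOn_of_mem_maximalAtlas h.codChart_mem_maximalAtlas
  have hψs := contMDiffOn_symm_of_mem_maximalAtlas h.codChart_mem_maximalAtlas
  rw [contMDiffOn_iff_contDiffOn] at hψ hψs
  let j : EuclideanSpace ℝ (Fin (k + 1)) →L[ℝ] Coord d :=
    h.equiv.toContinuousLinearMap.comp (ContinuousLinearMap.inl ℝ _ _)
  have hO : IsOpen (j ⁻¹' h.codChart.target) := h.codChart.open_target.preimage j.continuous
  refine ⟨h.domChart, j ⁻¹' h.codChart.target, h.codChart.symm ∘ j,
    fun w => (h.equiv.symm (h.codChart w)).1, h.mem_domChart_source,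
    h.domChart_mem_maximalAtlas, hO, ?_, hψs.comp j.contDiff.contDiffOn fun y hy => hy, ?_, ?_, ?_⟩
  · intro y hy
    have := h.target_subset_preimage_target hy
    rw [mem_preimage, OpenPartialHomeomorph.extend_target] at this
    exact this.1
  · intro y hy
    have h1 : DifferentiableAt ℝ h.codChart ((h.codChart.symm ∘ j) y) :=
      (hψ.contDiffAt (h.codChart.open_source.mem_nhds
        (h.codChart.map_target hy))).differentiableAt (by simp)
    exact ((h.equiv.symm.differentiableAt).comp _ h1).fst
  · intro y hy
    have : h.codChart (h.codChart.symm (j y)) = j y := h.codChart.right_inv hy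
    simp only [Function.comp_apply, this]
    simp [j]
  · intro z hz
    have h1 := h.writtenInCharts (IsParametrization.extend_mem_target hz)
    simp only [Function.comp_apply] at h1
    rw [h.domChart.extend_left_inv hz] at h1
    have h2 : h.codChart z = j (h.domChart.extend (𝓡∂ (k + 1)) z) := h1
    rw [Function.comp_apply, ← h2]
    exact h.codChart.left_inv (h.source_subset_preimage_source hz)

theorem isBoundaryPoint_iff_extend_eq_zero
    {φ : OpenPartialHomeomorph Y (EuclideanHalfSpace (k + 1))}
    (hφ : φ ∈ IsManifold.maximalAtlas (𝓡∂ (k + 1)) ∞ Y) {x : Y} (hx : x ∈ φ.source) :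
    (𝓡∂ (k + 1)).IsBoundaryPoint x ↔ φ.extend (𝓡∂ (k + 1)) x 0 = 0 := by
  have h1 : φ.extend (𝓡∂ (k + 1)) x ∈ range (𝓡∂ (k + 1)) := mem_range_self _
  rw [range_modelWithCornersEuclideanHalfSpace, mem_ofPred_eq] at h1
  rw [ModelWithCorners.isBoundaryPoint_iff_not_isInteriorPoint,
    isInteriorPoint_iff_of_mem_maximalAtlas hφ hx]
  constructor
  · intro h; linarith [not_lt.1 h]
  · intro h; rw [h]; exact lt_irrefl 0

/-- Since `z ≥ 0` on `Y`, a point with `z = 0` is a minimum of `z` over the chart, and the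
first-order condition holds in every direction pointing into the half-space. At interior points this
means all directions. -/
theorem IsParametrization.fderiv_snd_nonneg (hY : IsPSubmanifold k Y)
    {φ : OpenPartialHomeomorph Y (EuclideanHalfSpace (k + 1))}
    {O : Set (EuclideanSpace ℝ (Fin (k + 1)))} {ι : EuclideanSpace ℝ (Fin (k + 1)) → Coord d}
    {L : Coord d → EuclideanSpace ℝ (Fin (k + 1))} (h : IsParametrization φ O ι L) {x : Y}
    (hx : x ∈ φ.source) (hx0 : (x : Coord d).2 = 0) {v : EuclideanSpace ℝ (Fin (k + 1))}
    (hv : ∃ᶠ t : ℝ in 𝓝[>] 0, φ.extend (𝓡∂ (k + 1)) x + t • v ∈ range (𝓡∂ (k + 1))) :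
    0 ≤ (fderiv ℝ ι (φ.extend (𝓡∂ (k + 1)) x) v).2 := by
  have hmin : IsLocalMinOn (fun y => (ι y).2) (range (𝓡∂ (k + 1))) (φ.extend (𝓡∂ (k + 1)) x) := by
    filter_upwards [φ.extend_target_mem_nhdsWithin hx] with y hy
    have h1 : (φ.extend (𝓡∂ (k + 1))).symm y ∈ φ.source := by
      rw [← φ.extend_source (I := 𝓡∂ (k + 1))]
      exact (φ.extend _).map_target hy
    have h2 := h.apply_extend _ h1
    rw [(φ.extend _).right_inv hy] at h2
    rw [h.apply_extend x hx, hx0, h2]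
    exact hY.nonneg _ (Subtype.coe_prop _)
  exact hmin.hasFDerivWithinAt_nonneg
    ((h.differentiableAt (h.extend_mem hx)).hasFDerivAt.snd.hasFDerivWithinAt)
    (mem_posTangentConeAt_of_frequently_mem hv)

theorem IsParametrization.exists_fderiv_snd_eq_one (hY : IsPSubmanifold k Y)
    {φ : OpenPartialHomeomorph Y (EuclideanHalfSpace (k + 1))}
    {O : Set (EuclideanSpace ℝ (Fin (k + 1)))} {ι : EuclideanSpace ℝ (Fin (k + 1)) → Coord d}
    {L : Coord d → EuclideanSpace ℝ (Fin (k + 1))} (h : IsParametrization φ O ι L) {x : Y}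
    (hx : x ∈ φ.source) (hx0 : (x : Coord d).2 = 0) :
    ∃ v, (fderiv ℝ ι (φ.extend (𝓡∂ (k + 1)) x) v).2 = 1 := by
  obtain ⟨v, e, he, hve⟩ := hY.transversal x hx0 (0, 1)
  refine ⟨mfderiv (𝓡∂ (k + 1)) 𝓘(ℝ, EuclideanSpace ℝ (Fin (k + 1)))
    (φ.extend (𝓡∂ (k + 1))) x v, ?_⟩
  rw [← h.mfderiv_val hx]
  have h1 : (mfderiv (𝓡∂ (k + 1)) 𝓘(ℝ, Coord d) (Subtype.val : Y → Coord d) x v : Coord d).2 + e.2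
      = 1 := congr($hve.2).symm
  rwa [he, add_zero] at h1

/-- The submanifold meets `{z = 0}` exactly in its boundary. -/
theorem IsPSubmanifold.isBoundaryPoint_iff (hY : IsPSubmanifold k Y) (x : Y) :
    (𝓡∂ (k + 1)).IsBoundaryPoint x ↔ (x : Coord d).2 = 0 := by
  refine ⟨hY.boundary_subset x, fun hx0 => ?_⟩
  obtain ⟨φ, O, ι, L, hx, h⟩ := exists_isParametrization hY.embedded x
  rw [ModelWithCorners.isBoundaryPoint_iff_not_isInteriorPoint,
    isInteriorPoint_iff_of_mem_maximalAtlas h.mem_maximalAtlas hx]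
  intro hpos
  -- At an interior point both `v` and `-v` are admissible, so `dz` would vanish on `Y`, against
  -- transversality.
  have key : ∀ v, 0 ≤ (fderiv ℝ ι (φ.extend (𝓡∂ (k + 1)) x) v).2 := by
    intro v
    refine h.fderiv_snd_nonneg hY hx hx0 (Eventually.frequently ?_)
    have h1 : Tendsto (fun t : ℝ => φ.extend (𝓡∂ (k + 1)) x + t • v) (𝓝[>] 0)
        (𝓝 (φ.extend (𝓡∂ (k + 1)) x)) := by
      have : Continuous fun t : ℝ => φ.extend (𝓡∂ (k + 1)) x + t • v := by fun_prop
      simpa using (this.tendsto 0).mono_left nhdsWithin_le_nhds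
    refine h1.eventually (mem_interior_iff_mem_nhds.1 ?_)
    change _ ∈ interior (range (𝓡∂ (k + 1)))
    rwa [interior_range_modelWithCornersEuclideanHalfSpace]
  obtain ⟨v, hv⟩ := h.exists_fderiv_snd_eq_one hY hx hx0
  have := key (-v)
  rw [map_neg, Prod.snd_neg, hv] at this
  linarith

/-- Minimality makes `dz` nonnegative on inward vectors, hence zero on vectors tangent to the
boundary. Were it also zero on the inward vector, it would vanish identically, against
transversality. -/
theorem IsParametrization.fderiv_snd_inwardVector_pos (hY : IsPSubmanifold k Y)
    {φ : OpenPartialHomeomorph Y (EuclideanHalfSpace (k + 1))}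
    {O : Set (EuclideanSpace ℝ (Fin (k + 1)))} {ι : EuclideanSpace ℝ (Fin (k + 1)) → Coord d}
    {L : Coord d → EuclideanSpace ℝ (Fin (k + 1))} (h : IsParametrization φ O ι L) {x : Y}
    (hx : x ∈ φ.source) (hx0 : (x : Coord d).2 = 0) :
    0 < (fderiv ℝ ι (φ.extend (𝓡∂ (k + 1)) x) (inwardVector k)).2 := by
  have hy0 := (isBoundaryPoint_iff_extend_eq_zero h.mem_maximalAtlas hx).1
    ((hY.isBoundaryPoint_iff x).2 hx0)
  have key : ∀ v : EuclideanSpace ℝ (Fin (k + 1)), 0 ≤ v 0 →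
      0 ≤ (fderiv ℝ ι (φ.extend (𝓡∂ (k + 1)) x) v).2 := by
    intro v hv
    refine h.fderiv_snd_nonneg hY hx hx0 (Eventually.frequently ?_)
    filter_upwards [self_mem_nhdsWithin] with t ht
    rw [range_modelWithCornersEuclideanHalfSpace, mem_ofPred_eq]
    rw [PiLp.add_apply, hy0, zero_add]
    exact mul_nonneg (le_of_lt ht) hv
  refine lt_of_le_of_ne (key _ (by simp)) fun h0 => ?_
  obtain ⟨v, hv⟩ := h.exists_fderiv_snd_eq_one hY hx hx0
  have h1 := key (-(v - v 0 • inwardVector k)) (by simp)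
  simp only [map_neg, map_sub, map_smul, Prod.snd_neg, Prod.snd_sub, Prod.smul_snd, hv, ← h0,
    smul_eq_mul, mul_zero] at h1
  linarith

theorem fderiv_snd_mul {ρ τ : Coord d → ℝ} (hτ : ContDiff ℝ ∞ τ)
    (hρτ : ∀ w, ρ w = w.2 * τ w) {w : Coord d} (hw : w.2 = 0) (v : Coord d) :
    fderiv ℝ ρ w v = τ w * v.2 := by
  have h2 : HasFDerivAt (fun w : Coord d => w.2)
    (ContinuousLinearMap.snd ℝ (EuclideanSpace ℝ (Fin d)) ℝ) w := hasFDerivAt_snd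
  have h3 := (h2.mul (hτ.differentiable (by simp) w).hasFDerivAt).congr_of_eventuallyEq
    (f₁ := ρ) (Eventually.of_forall hρτ)
  rw [h3.fderiv]
  simp [hw]

/-- Near a boundary point there is a chart of `Y` whose first coordinate is any given smooth
function `ρ = z τ` with `τ` positive on `{z = 0}`. -/
theorem exists_isParametrization_of_radial [IsManifold (𝓡∂ (k + 1)) ∞ Y]
    (hY : IsPSubmanifold k Y) {ρ τ : Coord d → ℝ}
    (hρ : ContDiff ℝ ∞ ρ) (hτ : ContDiff ℝ ∞ τ) (hρτ : ∀ w, ρ w = w.2 * τ w)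
    (hpos : ∀ u, 0 < τ (u, 0)) {x : Y} (hx0 : (x : Coord d).2 = 0) :
    ∃ e T J K, x ∈ e.source ∧ IsParametrization (Y := Y) (k := k) e T J K ∧
      ∀ y ∈ T, ρ (J y) = y 0 := by
  obtain ⟨φ, O, ι, L, hx, h⟩ := exists_isParametrization hY.embedded x
  -- Intersecting with the chart target ensures that every `y` in this set with `y 0 = 0` comes from
  -- a boundary point of `Y`, so that `ρ ∘ ι` vanishes there.
  have hO' : IsOpen (O ∩ (𝓡∂ (k + 1)).symm ⁻¹' φ.target) :=
    h.isOpen.inter (φ.open_target.preimage (𝓡∂ (k + 1)).continuous_symm)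
  have hιO' := h.contDiffOn.mono (inter_subset_left (t := (𝓡∂ (k + 1)).symm ⁻¹' φ.target))
  have htgt : ∀ y, y ∈ (φ.extend (𝓡∂ (k + 1))).target ↔
      (𝓡∂ (k + 1)).symm y ∈ φ.target ∧ 0 ≤ y 0 := by
    intro y
    rw [φ.extend_target, range_modelWithCornersEuclideanHalfSpace]
    rfl
  have hx' := (htgt _).1 (IsParametrization.extend_mem_target hx)
  obtain ⟨Ψ, hΨx, hΨO, hΨs, hΨt, hΨ0, hΨ⟩ := exists_halfSpace_coordinate_change
    (R := fun y => ρ (ι y)) hO' (hρ.comp_contDiffOn hιO') (y₀ := φ.extend (𝓡∂ (k + 1)) x)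
    ⟨h.extend_mem hx, hx'.1⟩
    ((isBoundaryPoint_iff_extend_eq_zero h.mem_maximalAtlas hx).1
      ((hY.isBoundaryPoint_iff x).2 hx0)) (by
      intro y hy hy0
      have hyt : y ∈ (φ.extend (𝓡∂ (k + 1))).target := (htgt y).2 ⟨hy.2, hy0.ge⟩
      have h1 : (φ.extend (𝓡∂ (k + 1))).symm y ∈ φ.source := by
        rw [← φ.extend_source (I := 𝓡∂ (k + 1))]
        exact (φ.extend _).map_target hyt
      have h2 := h.apply_extend _ h1
      have h3 := (isBoundaryPoint_iff_extend_eq_zero h.mem_maximalAtlas h1).2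
      rw [(φ.extend _).right_inv hyt] at h2 h3
      rw [hρτ, h2, hY.boundary_subset _ (h3 hy0), zero_mul]) (by
      have h1 : fderiv ℝ (fun y => ρ (ι y)) (φ.extend (𝓡∂ (k + 1)) x) = _ :=
        fderiv_comp _ (hρ.differentiable (by simp) _) (h.differentiableAt (h.extend_mem hx))
      have h2 : (x : Coord d) = ((x : Coord d).1, 0) := by rw [← hx0]
      rw [h1, ContinuousLinearMap.comp_apply, h.apply_extend x hx, fderiv_snd_mul hτ hρτ hx0, h2]
      exact mul_pos (hpos _) (h.fderiv_snd_inwardVector_pos hY hx hx0))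
  have hsrc : ∀ {z : Y}, z ∈ (φ.trans (halfSpaceRestr Ψ hΨ)).source →
      z ∈ φ.source ∧ φ.extend (𝓡∂ (k + 1)) z ∈ Ψ.source := fun hz => hz
  have happ : ∀ {z : Y}, z ∈ (φ.trans (halfSpaceRestr Ψ hΨ)).source →
      (φ.trans (halfSpaceRestr Ψ hΨ)).extend (𝓡∂ (k + 1)) z = Ψ (φ.extend (𝓡∂ (k + 1)) z) :=
    fun hz => model_halfSpaceRestr hΨ (hsrc hz).2
  have hin : ∀ {y}, y ∈ Ψ.target → Ψ.symm y ∈ O := fun hy => (hΨO (Ψ.map_target hy)).1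
  refine ⟨φ.trans (halfSpaceRestr Ψ hΨ), Ψ.target, ι ∘ Ψ.symm, Ψ ∘ L, ⟨hx, hΨx⟩,
    ⟨trans_halfSpaceRestr_mem_maximalAtlas h.mem_maximalAtlas hΨ hΨs hΨt, Ψ.open_target, ?_,
      h.contDiffOn.comp hΨt fun y hy => hin hy, ?_, ?_, ?_⟩, ?_⟩
  · rw [OpenPartialHomeomorph.extend_target_eq_image_source]
    rintro _ ⟨z, hz, rfl⟩
    rw [happ hz]
    exact Ψ.map_source (hsrc hz).2
  · intro y hy
    refine DifferentiableAt.comp _ ?_ (h.differentiableAt_leftInv _ (hin hy))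
    rw [Function.comp_apply, h.leftInv _ (hin hy)]
    exact (hΨs.contDiffAt (Ψ.open_source.mem_nhds (Ψ.map_target hy))).differentiableAt (by simp)
  · intro y hy
    simp only [Function.comp_apply]
    rw [h.leftInv _ (hin hy), Ψ.right_inv hy]
  · intro z hz
    rw [happ hz, Function.comp_apply, Ψ.left_inv (hsrc hz).2, h.apply_extend z (hsrc hz).1]
  · intro y hy
    rw [Function.comp_apply, ← hΨ0 _ (Ψ.map_target hy), Ψ.right_inv hy]

end Parametrization

end CuspSing
end

noncomputable section

namespace CuspSing

/-! ### Smoothness of metrics and of pulled-back tensors. -/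

section Pullback

open Bundle ContinuousLinearMap

variable {E : Type*} [NormedAddCommGroup E] [NormedSpace ℝ E]
  {E' : Type*} [NormedAddCommGroup E'] [NormedSpace ℝ E']

/-- A Riemannian metric on a vector space, as a function with values in bilinear forms. -/
def metricForm (g : ContMDiffRiemannianMetric 𝓘(ℝ, E) ∞ E (fun x : E => TangentSpace 𝓘(ℝ, E) x))
    (x : E) : E →L[ℝ] E →L[ℝ] ℝ := g.inner x

theorem contDiff_metricForm [FiniteDimensional ℝ E]
    (g : ContMDiffRiemannianMetric 𝓘(ℝ, E) ∞ E (fun x : E => TangentSpace 𝓘(ℝ, E) x)) :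
    ContDiff ℝ ∞ (metricForm g) := by
  refine contDiff_clm_apply_iff.2 fun v => contDiff_clm_apply_iff.2 fun w => ?_
  have hc : ∀ v : E, ContMDiff 𝓘(ℝ, E) (𝓘(ℝ, E).prod 𝓘(ℝ, E)) ∞
      (fun x : E => TotalSpace.mk' E (E := fun x : E => TangentSpace 𝓘(ℝ, E) x) x v) := fun v =>
    contMDiff_vectorSpace_iff_contDiff.2 contDiff_const
  have h : ContMDiff 𝓘(ℝ, E) (𝓘(ℝ, E).prod 𝓘(ℝ, ℝ)) ∞
      (fun x : E => TotalSpace.mk' ℝ (E := Bundle.Trivial E ℝ) x (g.inner x v w)) :=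
    ContMDiff.clm_bundle_apply₂ (F₁ := E) (F₂ := E) g.contMDiff (hc v) (hc w)
  rw [← contMDiff_iff_contDiff]
  intro x
  exact (contMDiffAt_totalSpace.1 (h x)).2

variable {H : Type*} [TopologicalSpace H] {I : ModelWithCorners ℝ E H}
  {M : Type*} [TopologicalSpace M] [ChartedSpace H M] [IsManifold I ∞ M]

set_option synthInstance.maxHeartbeats 400000 in
/-- The pullback of a smooth family of bilinear forms under a smooth map is a smooth tensor. -/
theorem contMDiff_pullback_bilinear {f : M → E'} (hf : ContMDiff I 𝓘(ℝ, E') ∞ f)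
    {q : M → E' →L[ℝ] E' →L[ℝ] ℝ} (hq : ContMDiff I 𝓘(ℝ, E' →L[ℝ] E' →L[ℝ] ℝ) ∞ q)
    {G : (x : M) → TangentSpace I x →L[ℝ] TangentSpace I x →L[ℝ] ℝ}
    (hG : ∀ x v w, G x v w = q x (mfderiv I 𝓘(ℝ, E') f x v) (mfderiv I 𝓘(ℝ, E') f x w)) :
    ContMDiff I (I.prod 𝓘(ℝ, E →L[ℝ] E →L[ℝ] ℝ)) ∞
      (fun x : M => TotalSpace.mk' (E →L[ℝ] E →L[ℝ] ℝ)
        (E := fun x : M => TangentSpace I x →L[ℝ] TangentSpace I x →L[ℝ] ℝ) x (G x)) := by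
  intro x₀
  rw [contMDiffAt_hom_bundle]
  refine ⟨contMDiffAt_id, ?_⟩
  -- In tangent coordinates at `x₀` the pullback is `Aᵀ q A`, with `A` the smooth coordinate
  -- expression of the derivative of `f`.
  have hA := (hf x₀).mfderiv_const (m := ∞) (by simp)
  set A := inTangentCoordinates I 𝓘(ℝ, E') id f (mfderiv I 𝓘(ℝ, E') f) x₀ with hAdef
  have h1 : ContMDiffAt I 𝓘(ℝ, E →L[ℝ] E →L[ℝ] ℝ) ∞
      (fun x => (((compL ℝ E E' ℝ).flip (A x)).comp ((q x).comp (A x)))) x₀ :=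
    ((compL ℝ E E' ℝ).flip.contMDiff.contMDiffAt.comp x₀ hA).clm_comp ((hq x₀).clm_comp hA)
  refine h1.congr_of_eventuallyEq ?_
  filter_upwards [(chartAt H x₀).open_source.mem_nhds (mem_chart_source H x₀)] with x hx
  have hx' : x ∈ (trivializationAt E (TangentSpace I) x₀).baseSet := by
    rwa [TangentBundle.trivializationAt_baseSet]
  have hAx : ∀ v, A x v = mfderiv I 𝓘(ℝ, E') f x
      ((trivializationAt E (TangentSpace I) x₀).symm x v) := by
    intro v
    simp [hAdef, inTangentCoordinates, inCoordinates]
    exact congrArg (mfderiv I 𝓘(ℝ, E') f x) (Trivialization.symmL_apply _ hx' v)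
  ext v w
  rw [inCoordinates_apply_eq₂ hx' hx' (Set.mem_univ _), hG]
  simp [hAx]

end Pullback

end CuspSing
end

noncomputable section

namespace CuspSing

/-! ### From the ambient form to the cusp form in a boundary chart. -/

section CuspForm

open Set

variable {d k : ℕ}

/-- The boundary point with given angular coordinates. -/
def boundaryPoint (φ : EuclideanSpace ℝ (Fin k)) : EuclideanSpace ℝ (Fin (k + 1)) :=
  WithLp.toLp 2 (Fin.cons 0 φ)

theorem contDiff_boundaryPoint : ContDiff ℝ ∞ (boundaryPoint (k := k)) := by
  rw [contDiff_euclidean]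
  intro i
  refine Fin.cases ?_ (fun i => ?_) i
  · simpa [boundaryPoint] using contDiff_const
  · simp only [boundaryPoint, Fin.cons_succ]
    fun_prop

theorem boundaryPoint_angular (y : EuclideanSpace ℝ (Fin (k + 1))) :
    boundaryPoint (angular y) = y - y 0 • inwardVector k := by
  ext i
  refine Fin.cases ?_ (fun i => ?_) i <;> simp [boundaryPoint, angular, inwardVector]

theorem eq_smul_inwardVector_add_sum (V : EuclideanSpace ℝ (Fin (k + 1))) :
    V = V 0 • inwardVector k + ∑ i : Fin k, V i.succ • EuclideanSpace.single i.succ (1 : ℝ) := by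
  ext j
  refine Fin.cases ?_ (fun j => ?_) j <;> simp [inwardVector, Pi.single_apply, eq_comm]

/-- The form `C` need not be symmetric, whereas the `c i j` must be; symmetrizing leaves the
quadratic form unchanged. -/
theorem sum_sum_symm_mul {F : Type*} [NormedAddCommGroup F] [NormedSpace ℝ F]
    (C : F →L[ℝ] F →L[ℝ] ℝ) (U : Fin k → F) (ξ : Fin k → ℝ) (t : ℝ) :
    ∑ i, ∑ j, t * ((C (U i) (U j) + C (U j) (U i)) / 2) * ξ i * ξ j =
      t * C (∑ i, ξ i • U i) (∑ i, ξ i • U i) := by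
  have h : C (∑ i, ξ i • U i) (∑ i, ξ i • U i) = ∑ i, ∑ j, C (U i) (U j) * ξ i * ξ j := by
    simp only [map_sum, map_smul, sum_apply, smul_apply, smul_eq_mul]
    simp only [Finset.mul_sum]
    rw [Finset.sum_comm]
    exact Finset.sum_congr rfl fun i _ => Finset.sum_congr rfl fun j _ => by ring
  have h' : ∑ i, ∑ j, C (U i) (U j) * ξ i * ξ j = ∑ i, ∑ j, C (U j) (U i) * ξ i * ξ j := by
    rw [Finset.sum_comm]
    exact Finset.sum_congr rfl fun i _ => Finset.sum_congr rfl fun j _ => by ring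
  have h2 : t * C (∑ i, ξ i • U i) (∑ i, ξ i • U i) =
      t / 2 * (∑ i, ∑ j, C (U i) (U j) * ξ i * ξ j)
        + t / 2 * ∑ i, ∑ j, C (U j) (U i) * ξ i * ξ j := by
    rw [← h', h]; ring
  rw [h2]
  simp only [Finset.mul_sum, ← Finset.sum_add_distrib]
  exact Finset.sum_congr rfl fun i _ => Finset.sum_congr rfl fun j _ => by ring

theorem two_mul_sum_mul {F : Type*} [NormedAddCommGroup F] [NormedSpace ℝ F]
    (B : F →L[ℝ] ℝ) (C : F →L[ℝ] F →L[ℝ] ℝ) (U₀ : F) (U : Fin k → F) (ξ : Fin k → ℝ) (t s : ℝ) :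
    2 * ∑ i, t * ((B (U i) + C U₀ (U i) + C (U i) U₀) / 2) * s * ξ i =
      t * s * (B (∑ i, ξ i • U i) + C U₀ (∑ i, ξ i • U i) + C (∑ i, ξ i • U i) U₀) := by
  simp only [map_sum, map_smul, sum_apply, smul_apply, smul_eq_mul,
    Finset.mul_sum, ← Finset.sum_add_distrib]
  exact Finset.sum_congr rfl fun i _ => by ring

variable {Y : Set (Coord d)} [ChartedSpace (EuclideanHalfSpace (k + 1)) Y]
  [IsManifold (𝓡∂ (k + 1)) ∞ Y]

set_option maxHeartbeats 1000000 in
-- In a chart with `r = ρ` one has `z = r ζ` with `ζ = 1 / τ`, so powers of `z` become powers of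
-- `r`. Splitting `du` into its `dr` and `dφ` parts sends the extra `r⁴ dr²` terms into the
-- remainder of the radial coefficient.
theorem exists_hasCuspForm {ρ τ A : Coord d → ℝ} {B : Coord d → EuclideanSpace ℝ (Fin d) →L[ℝ] ℝ}
    {C : Coord d → EuclideanSpace ℝ (Fin d) →L[ℝ] EuclideanSpace ℝ (Fin d) →L[ℝ] ℝ}
    {N : Set (Coord d)} (hρ : ContDiff ℝ ∞ ρ) (hτ : ContDiff ℝ ∞ τ)
    (hρτ : ∀ w, ρ w = w.2 * τ w) (hN : IsOpen N) (hτpos : ∀ u, 0 < τ (u, 0))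
    (hA : ContDiffOn ℝ ∞ A N) (hB : ContDiffOn ℝ ∞ B N) (hC : ContDiffOn ℝ ∞ C N)
    (hCpos : ∀ u a, a ≠ 0 → 0 < C (u, 0) a a) (hY : IsPSubmanifold k Y)
    {x : Y} (hx : (𝓡∂ (k + 1)).IsBoundaryPoint x) (hxN : (x : Coord d) ∈ N)
    {g : (x : Y) → TangentSpace (𝓡∂ (k + 1)) x →L[ℝ] TangentSpace (𝓡∂ (k + 1)) x →L[ℝ] ℝ}
    (hg : ∀ x : Y, (x : Coord d) ∈ N → ∀ v : TangentSpace (𝓡∂ (k + 1)) x, ∀ v' : Coord d,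
      v' = mfderiv (𝓡∂ (k + 1)) 𝓘(ℝ, Coord d) (Subtype.val : Y → Coord d) x v →
      g x v v = (1 + (x : Coord d).2 ^ 2 * A x) * fderiv ℝ ρ x v' ^ 2 +
            (x : Coord d).2 ^ 4 * (B x v'.1 * fderiv ℝ ρ x v' + C x v'.1 v'.1)) :
    ∃ e ∈ IsManifold.maximalAtlas (𝓡∂ (k + 1)) ∞ Y, x ∈ e.source ∧ HasCuspForm e g := by
  have hx0 : (x : Coord d).2 = 0 := hY.boundary_subset x hx
  obtain ⟨e, T, J, K, hxe, he, hρJ⟩ := exists_isParametrization_of_radial hY hρ hτ hρτ hτpos hx0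
  set y₀ := e.extend (𝓡∂ (k + 1)) x with hy₀
  have hy₀0 : y₀ 0 = 0 := (isBoundaryPoint_iff_extend_eq_zero he.mem_maximalAtlas hxe).1 hx
  have hxτ : τ x ≠ 0 := by
    have : (x : Coord d) = ((x : Coord d).1, 0) := by rw [← hx0]
    rw [this]; exact (hτpos _).ne'
  let T₀ := T ∩ J ⁻¹' (N ∩ {w | τ w ≠ 0})
  have hT₀ : IsOpen T₀ := he.contDiffOn.continuousOn.isOpen_inter_preimage he.isOpen
    (hN.inter (isOpen_ne_fun hτ.continuous continuous_const))
  have hy₀T : y₀ ∈ T₀ := ⟨he.extend_mem hxe, by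
    rw [mem_preimage, hy₀, he.apply_extend x hxe]; exact ⟨hxN, hxτ⟩⟩
  let ζ : EuclideanSpace ℝ (Fin (k + 1)) → ℝ := fun y => (τ (J y))⁻¹
  let U : EuclideanSpace ℝ (Fin (k + 1)) → EuclideanSpace ℝ (Fin (k + 1)) →
    EuclideanSpace ℝ (Fin d) := fun v y => (fderiv ℝ J y v).1
  have hJ : ContDiffOn ℝ ∞ J T₀ := he.contDiffOn.mono inter_subset_left
  have hJN : MapsTo J T₀ N := fun y hy => hy.2.1
  have hζ : ContDiffOn ℝ ∞ ζ T₀ := (hτ.comp_contDiffOn hJ).inv fun y hy => hy.2.2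
  have hU : ∀ v, ContDiffOn ℝ ∞ (U v) T₀ := fun v =>
    contDiff_fst.comp_contDiffOn
      ((hJ.fderiv_of_isOpen hT₀ (m := ∞) (by simp)).clm_apply contDiffOn_const)
  have hAJ : ContDiffOn ℝ ∞ (fun y => A (J y)) T₀ := hA.comp hJ hJN
  have hBJ : ∀ v, ContDiffOn ℝ ∞ (fun y => B (J y) (U v y)) T₀ := fun v =>
    (hB.comp hJ hJN).clm_apply (hU v)
  have hCJ : ∀ v w, ContDiffOn ℝ ∞ (fun y => C (J y) (U v y) (U w y)) T₀ := fun v w =>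
    ((hC.comp hJ hJN).clm_apply (hU v)).clm_apply (hU w)
  -- The coefficient of `dr²` is `1 + r² G`: the `A`-term, and the `dr`-components of `B` and `C`,
  -- which carry a further `r²`.
  let G : EuclideanSpace ℝ (Fin (k + 1)) → ℝ := fun y => ζ y ^ 2 * A (J y) + y 0 ^ 2 * ζ y ^ 4 *
    (B (J y) (U (inwardVector k) y) + C (J y) (U (inwardVector k) y) (U (inwardVector k) y))
  have hG : ContDiffOn ℝ ∞ G T₀ := by
    have h0 : ContDiffOn ℝ ∞ (fun y : EuclideanSpace ℝ (Fin (k + 1)) => y 0 ^ 2) T₀ := by fun_prop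
    exact ((hζ.pow 2).mul hAJ).add ((h0.mul (hζ.pow 4)).mul ((hBJ _).add (hCJ _ _)))
  -- A global extension allows Hadamard's lemma to be applied along `r`: `G' = G'(0, φ) + r a`,
  -- whence `S = -G'(0, φ) / 2`.
  obtain ⟨G', hG', hGG'⟩ := exists_contDiff_eventuallyEq (hT₀.mem_nhds hy₀T) hG
  obtain ⟨δ, hδ, hball⟩ := Metric.mem_nhds_iff.1 (inter_mem (hT₀.mem_nhds hy₀T) hGG')
  obtain ⟨a, ha, haG, -⟩ := exists_contDiff_hadamard hG'
    (EuclideanSpace.proj 0 : EuclideanSpace ℝ (Fin (k + 1)) →L[ℝ] ℝ) (inwardVector k)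
  obtain ⟨e', hxe', -, he'⟩ := he.exists_restr hxe Metric.isOpen_ball (Metric.mem_ball_self hδ)
  have htgt : (e'.extend (𝓡∂ (k + 1))).target ⊆ T₀ := fun y hy =>
    (hball (he'.target_subset hy).2).1
  have hdρ : ∀ y ∈ T, ∀ V, fderiv ℝ ρ (J y) (fderiv ℝ J y V) = V 0 := by
    intro y hy V
    have h1 : (fun y => ρ (J y)) =ᶠ[𝓝 y]
        (EuclideanSpace.proj 0 : EuclideanSpace ℝ (Fin (k + 1)) →L[ℝ] ℝ) := by
      filter_upwards [he.isOpen.mem_nhds hy] with z hz using hρJ z hz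
    have h2 : fderiv ℝ (fun y => ρ (J y)) y = _ :=
      fderiv_comp y (hρ.differentiable (by simp) _) (he.differentiableAt hy)
    rw [h1.fderiv_eq, ContinuousLinearMap.fderiv] at h2
    exact congr($h2 V).symm
  have hUsum : ∀ y V, (fderiv ℝ J y V).1 = V 0 • U (inwardVector k) y +
      ∑ i : Fin k, V i.succ • U (EuclideanSpace.single i.succ 1) y := by
    intro y V
    conv_lhs => rw [eq_smul_inwardVector_add_sum V]
    simp [U, Prod.fst_sum]
  refine ⟨e', he'.mem_maximalAtlas, hxe', fun φ => -(1 / 2) * G' (boundaryPoint φ), a,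
    fun i y => ζ y ^ 4 * ((B (J y) (U (EuclideanSpace.single i.succ 1) y)
      + C (J y) (U (inwardVector k) y) (U (EuclideanSpace.single i.succ 1) y)
      + C (J y) (U (EuclideanSpace.single i.succ 1) y) (U (inwardVector k) y)) / 2),
    fun i j y => ζ y ^ 4 * ((C (J y) (U (EuclideanSpace.single i.succ 1) y)
        (U (EuclideanSpace.single j.succ 1) y)
      + C (J y) (U (EuclideanSpace.single j.succ 1) y)
        (U (EuclideanSpace.single i.succ 1) y)) / 2),
    ?_, ha.contDiffOn, fun i => ?_, fun i j => ?_, fun y _ i j => ?_, ?_, ?_⟩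
  · exact (contDiff_const.mul (hG'.comp contDiff_boundaryPoint)).contDiffOn
  · exact ((hζ.pow 4).mul ((((hBJ _).add (hCJ _ _)).add (hCJ _ _)).div_const 2)).mono htgt
  · exact ((hζ.pow 4).mul (((hCJ _ _).add (hCJ _ _)).div_const 2)).mono htgt
  · simp only [add_comm]
  · intro y hy hy0 ξ hξ
    rw [sum_sum_symm_mul]
    have hyT := htgt hy
    have hτy : τ (J y) ≠ 0 := hyT.2.2
    have hJ0 : (J y).2 = 0 := by
      have h1 := hρJ y hyT.1
      rw [hρτ, hy0] at h1
      exact (mul_eq_zero.1 h1).resolve_right hτy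
    -- A vector with zero `dr`-component has `dz = 0` on the boundary. As the parametrization is an
    -- immersion, its `du`-component is nonzero unless `ξ = 0`, and positivity of `C` applies.
    let Ξ : EuclideanSpace ℝ (Fin (k + 1)) := WithLp.toLp 2 (Fin.cons 0 ξ)
    have hΞ : (fderiv ℝ J y Ξ).1 = ∑ i, ξ i • U (EuclideanSpace.single i.succ 1) y := by
      rw [hUsum]
      simp [Ξ]
    have hJy : J y = ((J y).1, 0) := by rw [← hJ0]
    rw [← hΞ, hJy]
    refine mul_pos (by have := inv_ne_zero hτy; positivity) (hCpos _ _ fun h0 => hξ ?_)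
    have h2 : (fderiv ℝ J y Ξ).2 = 0 := by
      have h3 := hdρ y hyT.1 Ξ
      rw [fderiv_snd_mul hτ hρτ hJ0] at h3
      exact (mul_eq_zero.1 h3).resolve_left hτy
    have h4 : Ξ = 0 := he.injective_fderiv hyT.1 (by rw [map_zero]; exact Prod.ext h0 h2)
    funext i
    have := congr($h4 i.succ)
    simpa [Ξ] using this
  · intro z hz v
    dsimp only
    set y := e'.extend (𝓡∂ (k + 1)) z with hy
    have hyT : y ∈ T₀ := htgt (IsParametrization.extend_mem_target hz)
    have hJy : J y = z := he'.apply_extend z hz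
    have hGy : G y = G' (y - y 0 • inwardVector k) + y 0 * a y := by
      have h1 : G' y = G y := (hball (he'.extend_mem hz).2).2
      rw [← h1]
      exact haG y
    have hzζ : (J y).2 = y 0 * ζ y := by
      have hτy : τ (J y) ≠ 0 := hyT.2.2
      rw [← hρJ y hyT.1, hρτ, mul_assoc]
      simp only [ζ]
      rw [mul_inv_cancel₀ hτy, mul_one]
    have key : ∀ V : EuclideanSpace ℝ (Fin (k + 1)),
        (1 + (J y).2 ^ 2 * A (J y)) * fderiv ℝ ρ (J y) (fderiv ℝ J y V) ^ 2 +
            (J y).2 ^ 4 * (B (J y) (fderiv ℝ J y V).1 * fderiv ℝ ρ (J y) (fderiv ℝ J y V)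
              + C (J y) (fderiv ℝ J y V).1 (fderiv ℝ J y V).1) =
          (1 - 2 * y 0 ^ 2 * (-(1 / 2) * G' (boundaryPoint (angular y))) + y 0 ^ 3 * a y) *
            V 0 ^ 2 + y 0 ^ 4 * (2 * ∑ i : Fin k, ζ y ^ 4 *
              ((B (J y) (U (EuclideanSpace.single i.succ 1) y)
                + C (J y) (U (inwardVector k) y) (U (EuclideanSpace.single i.succ 1) y)
                + C (J y) (U (EuclideanSpace.single i.succ 1) y) (U (inwardVector k) y)) / 2) *
                V 0 * V i.succ +
            ∑ i : Fin k, ∑ j : Fin k, ζ y ^ 4 * ((C (J y) (U (EuclideanSpace.single i.succ 1) y)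
                (U (EuclideanSpace.single j.succ 1) y)
              + C (J y) (U (EuclideanSpace.single j.succ 1) y)
                (U (EuclideanSpace.single i.succ 1) y)) / 2) * V i.succ * V j.succ) := by
      intro V
      have hGe : G' (y - y 0 • inwardVector k) = G y - y 0 * a y := by rw [hGy]; ring
      rw [hdρ y hyT.1, hUsum, boundaryPoint_angular, sum_sum_symm_mul _ _ fun i : Fin k => V i.succ,
        two_mul_sum_mul _ _ _ _ fun i : Fin k => V i.succ, hzζ, hGe]
      simp only [G, map_add, map_smul, add_apply, smul_apply, smul_eq_mul]
      ring
    rw [hg z (hJy ▸ hJN hyT) v _ (he'.mfderiv_val hz v).symm, ← hJy]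
    exact key _

end CuspForm

end CuspSing
end

noncomputable section

namespace CuspSing

/-! ### Injectivity of the differentials and the metric in the coordinates `κ`. -/

section Coordinates

open Set

variable {d : ℕ} {p : EuclideanSpace ℝ (Fin (d + 1))}
  {κ : OpenPartialHomeomorph (Coord d) (EuclideanSpace ℝ (Fin (d + 1)))}

theorem injective_fderiv_quadBlowDown {w : Coord d} (hw : w.2 ≠ 0) :
    Function.Injective (fderiv ℝ (quadBlowDown d) w) := by
  rw [injective_iff_map_eq_zero]
  intro v hv
  rw [fderiv_quadBlowDown, Prod.mk_eq_zero] at hv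
  obtain ⟨h1, h2⟩ := hv
  rw [h2, mul_zero, zero_smul, add_zero, smul_eq_zero] at h1
  exact Prod.ext (h1.resolve_left (pow_ne_zero 2 hw)) h2

namespace IsCoordSystem

theorem differentiableAt (h : IsCoordSystem p κ) {w : Coord d} (hw : w ∈ κ.source) :
    DifferentiableAt ℝ κ w :=
  (h.contDiffOn.contDiffAt (κ.open_source.mem_nhds hw)).differentiableAt (by simp)

theorem injective_fderiv (h : IsCoordSystem p κ) {w : Coord d} (hw : w ∈ κ.source) :
    Function.Injective (fderiv ℝ κ w) := by
  refine injective_fderiv_of_leftInverse (h.differentiableAt hw)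
    ((h.contDiffOn_symm.contDiffAt (κ.open_target.mem_nhds (κ.map_source hw))).differentiableAt
      (by simp)) ?_
  filter_upwards [κ.open_source.mem_nhds hw] with z hz using κ.left_inv hz

/-- The ambient expansion needs a globally smooth form. Agreement near `0` suffices, since the
blow-down map sends a neighborhood of `{z = 0}` into any neighborhood of the origin. -/
theorem exists_contDiff_pullback (h : IsCoordSystem p κ)
    {q : EuclideanSpace ℝ (Fin (d + 1)) →
      EuclideanSpace ℝ (Fin (d + 1)) →L[ℝ] EuclideanSpace ℝ (Fin (d + 1)) →L[ℝ] ℝ}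
    (hq : ContDiff ℝ ∞ q) :
    ∃ q' : Coord d → Coord d →L[ℝ] Coord d →L[ℝ] ℝ, ContDiff ℝ ∞ q' ∧
      ∀ᶠ w in 𝓝 0, ∀ a b, q' w a b = q (κ w) (fderiv ℝ κ w a) (fderiv ℝ κ w b) := by
  have hd := h.contDiffOn.fderiv_of_isOpen κ.open_source (m := ∞) (by simp)
  have hs : ContDiffOn ℝ ∞
      (fun w => (q (κ w)).bilinearComp (fderiv ℝ κ w) (fderiv ℝ κ w)) κ.source := by
    refine contDiffOn_clm_apply.2 fun a => contDiffOn_clm_apply.2 fun b => ?_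
    exact ((hq.comp_contDiffOn h.contDiffOn).clm_apply (hd.clm_apply contDiffOn_const)).clm_apply
      (hd.clm_apply contDiffOn_const)
  obtain ⟨q', hq', he⟩ := exists_contDiff_eventuallyEq (κ.open_source.mem_nhds h.zero_mem) hs
  refine ⟨q', hq', ?_⟩
  filter_upwards [he] with w hw a b
  rw [hw]
  rfl

end IsCoordSystem

end Coordinates

section Pullback

variable {E : Type*} [NormedAddCommGroup E] [NormedSpace ℝ E] {H : Type*} [TopologicalSpace H]
  {I : ModelWithCorners ℝ E H} {M : Type*} [TopologicalSpace M] [ChartedSpace H M]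
  {F : Type*} [NormedAddCommGroup F] [NormedSpace ℝ F]

/-- The pullback under `f` of the field `q` of bilinear forms along `f`. -/
def pullbackForm (I : ModelWithCorners ℝ E H) (f : M → F) (q : M → F →L[ℝ] F →L[ℝ] ℝ) (x : M) :
    TangentSpace I x →L[ℝ] TangentSpace I x →L[ℝ] ℝ :=
  let f' : E →L[ℝ] F := mfderiv I 𝓘(ℝ, F) f x
  show E →L[ℝ] E →L[ℝ] ℝ from (q x).bilinearComp f' f'

end Pullback

section Resolution

/-! ### The pulled-back metric on the resolution. -/

open Set

variable {d k : ℕ} {X : Set (EuclideanSpace ℝ (Fin (d + 1)))} {p : EuclideanSpace ℝ (Fin (d + 1))}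
  {κ : OpenPartialHomeomorph (Coord d) (EuclideanSpace ℝ (Fin (d + 1)))} {Xt : Set (Coord d)}
  [ChartedSpace (EuclideanHalfSpace (k + 1)) Xt]

namespace IsCuspSingularityWithResolution

theorem mem_source (hX : IsCuspSingularityWithResolution k X p κ Xt) (x : Xt) :
    quadBlowDown d x ∈ κ.source :=
  hX.subset_source (mem_image_of_mem _ x.2)

theorem contMDiff (hX : IsCuspSingularityWithResolution k X p κ Xt) :
    ContMDiff (𝓡∂ (k + 1)) (𝓡 (d + 1)) ∞ (fun x : Xt => κ (quadBlowDown d x)) := by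
  have h : ContDiffOn ℝ ∞ (κ ∘ quadBlowDown d) (quadBlowDown d ⁻¹' κ.source) :=
    hX.coord.contDiffOn.comp contDiff_quadBlowDown.contDiffOn fun w hw => hw
  have ho := κ.open_source.preimage (contDiff_quadBlowDown (d := d)).continuous
  intro x
  exact ((h.contDiffAt (ho.mem_nhds (hX.mem_source x))).contMDiffAt).comp x
    (hX.resolution.embedded.contMDiff x)

theorem fderiv_comp (hX : IsCuspSingularityWithResolution k X p κ Xt) (x : Xt) (v : Coord d) :
    fderiv ℝ (fun w => κ (quadBlowDown d w)) (x : Coord d) v =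
      fderiv ℝ κ (quadBlowDown d x) (fderiv ℝ (quadBlowDown d) x v) := by
  have := _root_.fderiv_comp (x : Coord d) (hX.coord.differentiableAt (hX.mem_source x))
    (contDiff_quadBlowDown.differentiable (by simp) _)
  exact congr($this v)

theorem differentiableAt (hX : IsCuspSingularityWithResolution k X p κ Xt) (x : Xt) :
    DifferentiableAt ℝ (fun w => κ (quadBlowDown d w)) (x : Coord d) :=
  DifferentiableAt.comp (x : Coord d) (hX.coord.differentiableAt (hX.mem_source x))
    (contDiff_quadBlowDown.differentiable (by simp) _)

theorem mfderiv_apply (hX : IsCuspSingularityWithResolution k X p κ Xt) (x : Xt)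
    (v : TangentSpace (𝓡∂ (k + 1)) x) {v' : Coord d}
    (hv' : v' = mfderiv (𝓡∂ (k + 1)) 𝓘(ℝ, Coord d) (Subtype.val : Xt → Coord d) x v) :
    mfderiv (𝓡∂ (k + 1)) (𝓡 (d + 1)) (fun x : Xt => κ (quadBlowDown d x)) x v =
      fderiv ℝ κ (quadBlowDown d x) (fderiv ℝ (quadBlowDown d) x v') := by
  obtain ⟨φ, O, ι, L, hx, h⟩ := exists_isParametrization hX.resolution.embedded x
  rw [← hX.fderiv_comp, hv'.trans (h.mfderiv_val hx v)]
  exact h.mfderiv_comp_val hx (hX.differentiableAt x) v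

/-- An interior point has `z ≠ 0`, so every factor of the chain rule is injective: chart,
parametrization, blow-down map and `κ`. -/
theorem mfderiv_ne_zero [IsManifold (𝓡∂ (k + 1)) ∞ Xt]
    (hX : IsCuspSingularityWithResolution k X p κ Xt) {x : Xt}
    (hx : (𝓡∂ (k + 1)).IsInteriorPoint x) {v : TangentSpace (𝓡∂ (k + 1)) x} (hv : v ≠ 0) :
    mfderiv (𝓡∂ (k + 1)) (𝓡 (d + 1)) (fun x : Xt => κ (quadBlowDown d x)) x v ≠ 0 := by
  obtain ⟨φ, O, ι, L, hxφ, h⟩ := exists_isParametrization hX.resolution.embedded x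
  have hx2 : (x : Coord d).2 ≠ 0 := by
    rw [Ne, ← hX.resolution.isBoundaryPoint_iff,
      ModelWithCorners.isBoundaryPoint_iff_not_isInteriorPoint, not_not]
    exact hx
  intro h0
  have h1 := (hX.mfderiv_apply x v rfl).symm.trans h0
  have h2 := (injective_iff_map_eq_zero _).1 (hX.coord.injective_fderiv (hX.mem_source x)) _ h1
  have h3 := (injective_iff_map_eq_zero _).1 (injective_fderiv_quadBlowDown hx2) _ h2
  have h4 := (injective_iff_map_eq_zero _).1 (h.injective_fderiv (h.extend_mem hxφ)) _
    ((h.mfderiv_val hxφ v).symm.trans h3)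
  exact hv ((injective_iff_map_eq_zero _).1 (h.injective_mfderiv_extend hxφ) _ h4)

theorem exists_hasCuspForm_pullback [IsManifold (𝓡∂ (k + 1)) ∞ Xt]
    (hX : IsCuspSingularityWithResolution k X p κ Xt)
    {q : EuclideanSpace ℝ (Fin (d + 1)) →
      EuclideanSpace ℝ (Fin (d + 1)) →L[ℝ] EuclideanSpace ℝ (Fin (d + 1)) →L[ℝ] ℝ}
    (hq : ContDiff ℝ ∞ q) (hsymm : ∀ y v w, q y v w = q y w v)
    (hpos : ∀ y v, v ≠ 0 → 0 < q y v v) {x : Xt} (hx : (𝓡∂ (k + 1)).IsBoundaryPoint x) :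
    ∃ e ∈ IsManifold.maximalAtlas (𝓡∂ (k + 1)) ∞ Xt, x ∈ e.source ∧
      HasCuspForm e (pullbackForm (𝓡∂ (k + 1)) (fun x : Xt => κ (quadBlowDown d x))
        fun x => q (κ (quadBlowDown d x))) := by
  obtain ⟨q', hq', hqq'⟩ := hX.coord.exists_contDiff_pullback hq
  obtain ⟨W, hW, hWo, h0W⟩ := eventually_nhds_iff.1 hqq'
  obtain ⟨ρ, τ, A, B, C, N, hρ, hτ, hρτ, hN, hN0, hτpos, hA, hB, hC, hCpos, hform⟩ :=
    exists_cuspForm_quadBlowDown hq'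
      (fun v w => by rw [hW 0 h0W, hW 0 h0W, hsymm])
      (fun v hv => by
        rw [hW 0 h0W]
        refine hpos _ _ fun h => hv ?_
        exact (injective_iff_map_eq_zero _).1 (hX.coord.injective_fderiv hX.coord.zero_mem) _ h)
  -- On this set `q'` is the true pullback of `q`; it contains every point with `z = 0`.
  have hsub : N ∩ quadBlowDown d ⁻¹' W ⊆ N := inter_subset_left
  have hxe : (x : Coord d) = ((x : Coord d).1, 0) :=
    Prod.ext rfl (hX.resolution.boundary_subset x hx)
  refine exists_hasCuspForm hρ hτ hρτ (hN.inter (hWo.preimage contDiff_quadBlowDown.continuous))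
    hτpos (hA.mono hsub) (hB.mono hsub) (hC.mono hsub) hCpos hX.resolution hx ⟨?_, ?_⟩ ?_
  · rw [hxe]; exact hN0 _
  · rw [mem_preimage, hxe]
    simpa [quadBlowDown, ← Prod.zero_eq_mk] using h0W
  · rintro z ⟨hzN, hzW⟩ v v' hv'
    rw [← hform z hzN, hW _ hzW]
    change q _ (mfderiv (𝓡∂ (k + 1)) (𝓡 (d + 1)) (fun x : Xt => κ (quadBlowDown d x)) z v)
      (mfderiv (𝓡∂ (k + 1)) (𝓡 (d + 1)) (fun x : Xt => κ (quadBlowDown d x)) z v) = _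
    rw [hX.mfderiv_apply z v hv']

end IsCuspSingularityWithResolution

end Resolution

end CuspSing
end

theorem proposition2p2 {d k : ℕ} (X : Set (EuclideanSpace ℝ (Fin (d + 1))))
    (p : EuclideanSpace ℝ (Fin (d + 1)))
    (κ : OpenPartialHomeomorph (CuspSing.Coord d) (EuclideanSpace ℝ (Fin (d + 1))))
    (Xt : Set (CuspSing.Coord d))
    [ChartedSpace (EuclideanHalfSpace (k + 1)) Xt] [IsManifold (𝓡∂ (k + 1)) ∞ Xt]
    (hX : CuspSing.IsCuspSingularityWithResolution k X p κ Xt)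
    (g : Bundle.ContMDiffRiemannianMetric (𝓡 (d + 1)) ∞ (EuclideanSpace ℝ (Fin (d + 1)))
      (fun x : EuclideanSpace ℝ (Fin (d + 1)) => TangentSpace (𝓡 (d + 1)) x)) :
    ∃ gt : (x : Xt) → TangentSpace (𝓡∂ (k + 1)) x →L[ℝ] TangentSpace (𝓡∂ (k + 1)) x →L[ℝ] ℝ,
      CuspSing.IsCuspMetric gt ∧
      ∀ x : Xt, (𝓡∂ (k + 1)).IsInteriorPoint x → ∀ v w : TangentSpace (𝓡∂ (k + 1)) x,
        gt x v w = g.inner (κ (CuspSing.quadBlowDown d x))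
          (mfderiv (𝓡∂ (k + 1)) (𝓡 (d + 1)) (fun x : Xt => κ (CuspSing.quadBlowDown d x)) x v)
          (mfderiv (𝓡∂ (k + 1)) (𝓡 (d + 1)) (fun x : Xt => κ (CuspSing.quadBlowDown d x)) x w) := by
  have hg := CuspSing.contDiff_metricForm g
  have hsymm : ∀ y v w, CuspSing.metricForm g y v w = CuspSing.metricForm g y w v := g.symm
  have hpos : ∀ y v, v ≠ 0 → 0 < CuspSing.metricForm g y v v := g.pos
  have hnonneg : ∀ y v, 0 ≤ CuspSing.metricForm g y v v := fun y v => by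
    rcases eq_or_ne v 0 with rfl | h
    · simp
    · exact (hpos y v h).le
  -- The extension is the pullback itself, which makes sense on the boundary too, so the required
  -- equality is definitional.
  refine ⟨CuspSing.pullbackForm (𝓡∂ (k + 1)) (fun x : Xt => κ (CuspSing.quadBlowDown d x))
    fun x => CuspSing.metricForm g (κ (CuspSing.quadBlowDown d x)),
    ⟨?_, fun x v w => hsymm _ _ _, fun x v => hnonneg _ _, fun x hx v hv => ?_, fun x hx => ?_⟩,
    fun x _ v w => rfl⟩
  · exact CuspSing.contMDiff_pullback_bilinear hX.contMDiff
      (hg.contMDiff.comp hX.contMDiff) fun x v w => rfl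
  · exact hpos _ _ (hX.mfderiv_ne_zero hx hv)
  · exact hX.exists_hasCuspForm_pullback hg hsymm hpos hx
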